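/- Let $\Lambda$ be a complete separable metric space with its Borel $\sigma$-algebra and let $\lambda$ be a $\sigma$-finite reference measure on $\Lambda$. Let $\mathcal M(\Lambda)$ be the space of counting measures on $\Lambda$ (countable sums of unit point masses, multiple points allowed) that are finite on bounded sets, with the $\sigma$-algebra generated by the evaluations $\xi\mapsto\xi(B)$, $B$ Borel. A point process is a probability measure on $\mathcal M(\Lambda)$. It is determinantal with (measurable) correlation kernel $\mathbb K:\Lambda\times\Lambda\to\mathbb C$ if for every $n$ it has an $n$-th correlation function $\rho_n\ge 0$ with $\rho_n(x_1,\dots,x_n)=\det(\mathbb K(x_i,x_j))_{i,j=1}^n$ for $\lambda^{n}$-almost every $(x_1,\dots,x_n)$; that is, for disjoint Borel sets $A_1,\dots,A_m$ and $n_1+\dots+n_m=n$, $$\mathbb E\Big[\prod_{i=1}^m\xi(A_i)(\xi(A_i)-1)\cdots(\xi(A_i)-n_i+1)\Big]=\int_{A_1^{n_1}\times\dots\times A_m^{n_m}}\rho_n\,d\lambda^{n}.$$ Let $C_c^+(\Lambda)$ be the set of non-negative continuous functions on $\Lambda$ with compact support. For a kernel $T$ on $\Lambda$ write $$\det(I-T)=\sum_{n\ge0}\frac{(-1)^n}{n!}\int_{\Lambda^n}\det(T(x_i,x_j))_{i,j=1}^n\,d\lambda^n(x)$$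 for the Fredholm determinant on $L^2(\Lambda,\lambda)$ given by its Fredholm expansion, when all the integrands are integrable and the series converges absolutely. For functions $f$ and sets $A$, $f\,\mathbb K\,\mathbb 1_A$ denotes the kernel $f(x)\mathbb K(x,y)\mathbb 1_A(y)$. Let $\nu$ be a determinantal point process on $\Lambda$ with correlation kernel $\mathbb K$, let $0\le\alpha\le1$ and $0\le\beta<1$. The thinned process is obtained from $\nu$ by keeping each point independently with probability $\alpha$ and removing it otherwise. The thickened process is obtained from $\nu$ by giving each point independently a multiplicity $m$ with $\mathbb P[m=k]=(1-\beta)\beta^{k-1}$, $k\ge1$. (1) The thinned process is a determinantal point process with correlation kernel $\alpha\mathbb K$, and the thickened process is a point process (possibly with multiple points). Suppose in addition that for every $\psi\in C_c^+(\Lambda)$, with $\phi=1-e^{-\psi}$ and $A=\operatorname{supp}\psi$, the Fredholm expansion of $\det(I-\phi\,\mathbb K\,\mathbb 1_A)$ converges absolutely. Then the Fredholm expansions of the determinants below converge absolutely for every $\psi\in C_c^+(\Lambda)$ (with the same notation $\phi$, $A$), and: (2) if $\{x_j\}$ are the points of the thinned process, $$\mathbb E\Big[e^{-\sum_j\psi(x_j)}\Big]=\det(I-\phi\,\alpha\mathbb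 K\,\mathbb 1_A)\qquad\text{for every }\psi\in C_c^+(\Lambda);$$ (3) if $\{x_j\}$ is the multiset of points of the thickened process, $$\mathbb E\Big[e^{-\sum_j\psi(x_j)}\Big]=\det\Big(I-\frac{\phi}{1-\beta+\beta\phi}\,\mathbb K\,\mathbb 1_A\Big)\qquad\text{for every }\psi\in C_c^+(\Lambda);$$ (4) if $\Lambda$ is locally compact, the thickened process is characterized by (3): every point process on $\Lambda$ that satisfies this identity for all $\psi\in C_c^+(\Lambda)$ has the same law as the thickened process. -/

import Mathlib

open MeasureTheory ProbabilityTheory Set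
open scoped NNReal ENNReal unitInterval

noncomputable section

namespace ThinThick

/-! ### Configurations and point processes -/

/-- `IsCountingMeasure ξ`: the measure `ξ` is a sum of countably many unit point masses (repetitions
are allowed, so points may be multiple) and every bounded set has finite mass. -/
def IsCountingMeasure {X : Type*} [MetricSpace X] [MeasurableSpace X] (ξ : Measure X) : Prop :=
  (∃ (s : Set ℕ) (y : s → X), ξ = Measure.sum fun j : s => Measure.dirac (y j)) ∧
    ∀ B : Set X, Bornology.IsBounded B → ξ B < ∞

/-- The space of counting measures on `X` that are finite on bounded sets. Its σ-algebra is the one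
generated by the evaluations `ξ ↦ ξ B`, `B` measurable. -/
def CountingMeasure (X : Type*) [MetricSpace X] [MeasurableSpace X] : Type _ :=
  {ξ : Measure X // IsCountingMeasure ξ}

instance {X : Type*} [MetricSpace X] [MeasurableSpace X] :
    MeasurableSpace (CountingMeasure X) :=
  inferInstanceAs (MeasurableSpace {ξ : Measure X // IsCountingMeasure ξ})

/-- A countable sum of integer multiples of point masses is a sum of countably many unit point
masses. -/
theorem exists_sum_dirac {X : Type*} [MeasurableSpace X] {ι : Type*} [Countable ι] (y : ι → X) (n : ι → ℕ) :
    ∃ (s : Set ℕ) (z : s → X),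
      (Measure.sum fun i => (n i : ℝ≥0∞) • Measure.dirac (y i)) =
        Measure.sum fun j : s => Measure.dirac (z j) := by
  obtain ⟨f, hf⟩ := Countable.exists_injective_nat (Σ i, Fin (n i))
  let e := Equiv.ofInjective f hf
  refine ⟨Set.range f, fun j => y (e.symm j).1, ?_⟩
  ext B hB
  rw [Measure.sum_apply _ hB, Measure.sum_apply _ hB,
    ← e.tsum_eq (fun j => (Measure.dirac (y (e.symm j).1)) B), ENNReal.tsum_sigma']
  simp

variable {X : Type*} [MetricSpace X] [MeasurableSpace X]

namespace CountingMeasure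

/-- The underlying measure of a configuration. -/
def toMeasure (ξ : CountingMeasure X) : Measure X := ξ.1

/-- The index set of an enumeration of the points of `ξ`. -/
def index (ξ : CountingMeasure X) : Set ℕ := ξ.2.1.choose

/-- An enumeration of the points of `ξ`, a multiple point being listed according to its
multiplicity. -/
def point (ξ : CountingMeasure X) : ξ.index → X := ξ.2.1.choose_spec.choose

theorem toMeasure_eq_sum_dirac (ξ : CountingMeasure X) :
    ξ.toMeasure = Measure.sum fun j : ξ.index => Measure.dirac (ξ.point j) :=
  ξ.2.1.choose_spec.choose_spec

end CountingMeasure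

/-- Giving the `j`-th point of `ξ` the multiplicity `n j` results in a configuration. -/
theorem isCountingMeasure_sum_smul_dirac [BorelSpace X] (ξ : CountingMeasure X)
    (n : ξ.index → ℕ) :
    IsCountingMeasure
      (Measure.sum fun j => (n j : ℝ≥0∞) • Measure.dirac (ξ.point j)) := by
  refine ⟨exists_sum_dirac ξ.point n, fun B hB => ?_⟩
  have hfin : ξ.toMeasure (closure B) < ∞ := ξ.2.2 _ hB.closure
  have hm : MeasurableSet (closure B) := isClosed_closure.measurableSet
  refine lt_of_le_of_lt (measure_mono subset_closure) ?_
  rw [ξ.toMeasure_eq_sum_dirac, Measure.sum_apply _ hm] at hfin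
  rw [Measure.sum_apply _ hm]
  have hF := ENNReal.finite_const_le_of_tsum_ne_top hfin.ne one_ne_zero
  rw [tsum_eq_sum (s := hF.toFinset)]
  · refine ENNReal.sum_lt_top.2 fun j _ => ?_
    rw [Measure.smul_apply, smul_eq_mul]
    exact ENNReal.mul_lt_top (by simp) (measure_lt_top _ _)
  · intro j hj
    have hj' : ξ.point j ∉ closure B := by
      intro h
      apply hj
      simp [Measure.dirac_apply' _ hm, h]
    simp [Measure.dirac_apply' _ hm, hj']

/-- The configuration in which the `j`-th point of `ξ` is taken with multiplicity `n j` (it is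
removed when `n j = 0`). -/
def CountingMeasure.withMultiplicity [BorelSpace X] (ξ : CountingMeasure X) (n : ξ.index → ℕ) :
    CountingMeasure X :=
  ⟨Measure.sum fun j => (n j : ℝ≥0∞) • Measure.dirac (ξ.point j),
    isCountingMeasure_sum_smul_dirac ξ n⟩

/-! ### Independent thinning and thickening -/

/-- The law of the configuration obtained from the fixed configuration `ξ` by giving its points
independent random multiplicities with common law `p`. It does not depend on the enumeration of the
points of `ξ`. -/
def multiplicityLaw [BorelSpace X] (p : Measure ℕ) [IsProbabilityMeasure p]
    (ξ : CountingMeasure X) : Measure (CountingMeasure X) :=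
  (Measure.infinitePi fun _ : ξ.index => p).map ξ.withMultiplicity

/-- The law of the point process obtained from a point process with law `P` by giving its points
random multiplicities with law `p`, independent of each other and of the process. -/
def randomMultiplicity [BorelSpace X] (p : Measure ℕ) [IsProbabilityMeasure p]
    (P : Measure (CountingMeasure X)) : Measure (CountingMeasure X) :=
  P.bind (multiplicityLaw p)

/-- The geometric law `k ↦ (1 - β) * β ^ (k - 1)` on `k ≥ 1`: the number of failures before the
first success, at success probability `1 - β`, plus one. -/
def shiftedGeometric (β : I) : Measure ℕ := (geometricMeasure (σ β)).map (· + 1)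

instance (β : I) : IsProbabilityMeasure (shiftedGeometric β) :=
  Measure.isProbabilityMeasure_map (by fun_prop)

/-- Thinning: each point is kept with probability `α` and removed with probability `1 - α`,
independently. -/
def thinned [BorelSpace X] (α : I) (P : Measure (CountingMeasure X)) :
    Measure (CountingMeasure X) :=
  randomMultiplicity (bernoulliMeasure (1 : ℕ) 0 α) P

/-- Thickening: each point gets an independent multiplicity `m` with
`ℙ[m = k] = (1 - β) * β ^ (k - 1)`, `k ≥ 1`. -/
def thickened [BorelSpace X] (β : I) (P : Measure (CountingMeasure X)) :
    Measure (CountingMeasure X) :=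
  randomMultiplicity (shiftedGeometric β) P

/-! ### Correlation functions and determinantal processes -/

/-- `t (t - 1) ⋯ (t - k + 1)`; at `t = ∞` this is `∞` for `k ≥ 1`. For natural numbers `t < k`
it vanishes, since one of the factors does. -/
def fallingFactorial (t : ℝ≥0∞) (k : ℕ) : ℝ≥0∞ := ∏ j ∈ Finset.range k, (t - j)

/-- `ρ` is an `n`-th correlation function of the point process `P` with respect to the reference
measure `l`: for disjoint Borel sets `A 0, …, A (m - 1)` the factorial moment
`𝔼 [∏ i, ξ(A i)! / (ξ(A i) - n i)!]`, `∑ i, n i = n`, is the integral of `ρ` over the product of the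
`A i`, each repeated `n i` times. The map `c` says which coordinates belong to which set, so that
`n i` is the number of `k` with `c k = i`. -/
def IsCorrelationFunction (l : Measure X) (P : Measure (CountingMeasure X)) {n : ℕ}
    (ρ : (Fin n → X) → ℝ≥0) : Prop :=
  Measurable ρ ∧
    ∀ (m : ℕ) (A : Fin m → Set X), (∀ i, MeasurableSet (A i)) →
      (Pairwise fun i j => Disjoint (A i) (A j)) → ∀ c : Fin n → Fin m,
        ∫⁻ ξ, ∏ i, fallingFactorial (ξ.toMeasure (A i)) (Finset.univ.filter (c · = i)).card ∂P =
          ∫⁻ x in {x : Fin n → X | ∀ k, x k ∈ A (c k)}, (ρ x : ℝ≥0∞) ∂(Measure.pi fun _ => l)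

/-- `P` is (the law of) a determinantal point process with correlation kernel `K` with respect to
the reference measure `l`. -/
structure IsDeterminantal (l : Measure X) (K : X → X → ℂ) (P : Measure (CountingMeasure X)) :
    Prop where
  isProbabilityMeasure : IsProbabilityMeasure P
  measurable_kernel : Measurable (Function.uncurry K)
  correlation : ∀ n : ℕ, ∃ ρ : (Fin n → X) → ℝ≥0, IsCorrelationFunction l P ρ ∧
    ∀ᵐ x ∂(Measure.pi fun _ : Fin n => l),
      ((ρ x : ℝ) : ℂ) = (Matrix.of fun i j => K (x i) (x j)).det

/-! ### Fredholm determinants and Laplace functionals -/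

/-- `HasFredholmDet l T d`: the Fredholm expansion
`∑ n, (-1)ⁿ / n! ∫ det (T (x i) (x j)) dlⁿ(x)` of `det (I - T)` on `L²(X, l)` converges absolutely,
and its sum is `d`. -/
def HasFredholmDet (l : Measure X) (T : X → X → ℂ) (d : ℂ) : Prop :=
  (∀ n : ℕ, Integrable (fun x : Fin n → X => (Matrix.of fun i j => T (x i) (x j)).det)
    (Measure.pi fun _ => l)) ∧
  HasSum (fun n : ℕ => (-1) ^ n / (n.factorial : ℂ) *
    ∫ x : Fin n → X, (Matrix.of fun i j => T (x i) (x j)).det ∂(Measure.pi fun _ => l)) d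

/-- The kernel `f(x) K(x, y) 𝟙_A(y)` of the operator `f K 𝟙_A`. -/
def cutKernel (f : X → ℝ) (K : X → X → ℂ) (A : Set X) : X → X → ℂ :=
  fun x y => (f x : ℂ) * K x y * A.indicator 1 y

/-- The non-negative continuous functions with compact support. -/
def CcPos (X : Type*) [TopologicalSpace X] : Set (X → ℝ) :=
  {ψ | Continuous ψ ∧ HasCompactSupport ψ ∧ ∀ x, 0 ≤ ψ x}

/-- The Laplace functional `𝔼 [exp (-∑ j, ψ(x j))]`, the sum being over the points of the
configuration with their multiplicities. -/
def laplace (P : Measure (CountingMeasure X)) (ψ : X → ℝ) : ℝ :=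
  ∫ ξ, Real.exp (-∫ x, ψ x ∂ξ.toMeasure) ∂P

end ThinThick

end

/-! Independent multiplicities with law `p` act on Laplace functionals by substitution. Given the
configuration, a point at x contributes the factor 𝔼 e^{-mψ(x)}, so the new functional at ψ is the
old one at Tψ = -log 𝔼 e^{-mψ} (`laplace_randomMultiplicity`). With φ = 1 - e^{-ψ}, the function 1 -
e^{-Tψ} is αφ for thinning and φ/(1-β+βφ) for thickening.

The Laplace functional of a determinantal process is a Fredholm determinant
(`IsDeterminantal.hasFredholmDet_laplace`): expanding ∏ (1 - f(x_j)) gives an alternating series in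
sums over n-tuples of distinct points, and Campbell's formula turns their expectations into the
integrals of the Fredholm expansion. These integrals are nonnegative, so absolute convergence is
summability of factorial moments divided by n!, a condition monotone in f. Monotonicity settles
thinning, as αφ ≤ φ. It fails for thickening, as φ/(1-β+βφ) ≥ φ; there Tψ is again in `CcPos` with
the same support, and the convergence hypothesis is applied to Tψ itself.

The kernel αK arises because n distinct points all survive with probability α^n, and α^n det K =
det(αK).

For uniqueness, the functionals exp(-∫ψ dξ) are closed under products and generate the σ-algebra,
hence determine the law (`IsMultiplicativeClass.ext`, `isMultiplicativeClass_ccPos`). -/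

namespace ThinThick

/-! ### Multiplicative classes of functions -/

section MultiplicativeClass

open Filter Topology

variable {Ω : Type*}

/-- The indicator of `S` is a boundedly pointwise limit of a sequence of functions in `V`. -/
def IsBoundedLimit (V : Subalgebra ℝ (Ω → ℝ)) (S : Set Ω) : Prop :=
  ∃ g : ℕ → Ω → ℝ, (∀ n, g n ∈ V) ∧ (∃ M : ℝ, ∀ n ω, |g n ω| ≤ M) ∧
    ∀ ω, Tendsto (fun n => g n ω) atTop (𝓝 (S.indicator 1 ω))

theorem IsBoundedLimit.inter {V : Subalgebra ℝ (Ω → ℝ)} {S T : Set Ω}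
    (hS : IsBoundedLimit V S) (hT : IsBoundedLimit V T) : IsBoundedLimit V (S ∩ T) := by
  obtain ⟨g, hg, ⟨M, hM⟩, hgS⟩ := hS
  obtain ⟨h, hh, ⟨N, hN⟩, hhT⟩ := hT
  refine ⟨fun n => g n * h n, fun n => V.mul_mem (hg n) (hh n), ⟨M * N, fun n ω => ?_⟩,
    fun ω => ?_⟩
  · change |g n ω * h n ω| ≤ _
    rw [abs_mul]
    exact mul_le_mul (hM n ω) (hN n ω) (abs_nonneg _) ((abs_nonneg _).trans (hM n ω))
  · rw [inter_indicator_one]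
    exact (hgS ω).mul (hhT ω)

theorem isPiSystem_isBoundedLimit (V : Subalgebra ℝ (Ω → ℝ)) :
    IsPiSystem {S | IsBoundedLimit V S} := fun _ hS _ hT _ => hS.inter hT

/-- The functions min(1, n(f - a)⁺) increase to the indicator. Each is a continuous function of f,
so by Weierstrass on [0, 1] it lies within 1/(n+1) of a polynomial in f, which belongs to V. -/
theorem isBoundedLimit_lt {V : Subalgebra ℝ (Ω → ℝ)} {f : Ω → ℝ} (hf : f ∈ V)
    (hI : ∀ ω, f ω ∈ Icc (0 : ℝ) 1) (a : ℝ) : IsBoundedLimit V {ω | a < f ω} := by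
  let h : ℕ → C(Icc (0 : ℝ) 1, ℝ) := fun n =>
    ⟨fun x => min 1 (n * max ((x : ℝ) - a) 0), by fun_prop⟩
  choose p hp using fun n : ℕ =>
    exists_polynomial_near_continuousMap 0 1 (h n) (1 / ((n : ℝ) + 1)) (by positivity)
  have key : ∀ n ω, |(p n).eval (f ω) - min 1 (n * max (f ω - a) 0)| < 1 / ((n : ℝ) + 1) := by
    intro n ω
    have := (ContinuousMap.norm_coe_le_norm _ ⟨f ω, hI ω⟩).trans_lt (hp n)
    simpa [h] using this
  have hle : ∀ n : ℕ, 1 / ((n : ℝ) + 1) ≤ 1 := fun n => by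
    rw [div_le_one (by positivity)]; simp
  refine ⟨fun n => Polynomial.aeval f (p n), fun n => ?_, ⟨2, fun n ω => ?_⟩, fun ω => ?_⟩
  · exact Algebra.adjoin_le (by simpa using hf) (Polynomial.aeval_mem_adjoin_singleton ℝ f)
  · have h0 : 0 ≤ min (1 : ℝ) (n * max (f ω - a) 0) := by positivity
    have h1 : min (1 : ℝ) (n * max (f ω - a) 0) ≤ 1 := min_le_left _ _
    have e : (Polynomial.aeval f (p n)) ω = (p n).eval (f ω) := by
      simp
    have := abs_lt.1 ((key n ω).trans_le (hle n))
    change |(Polynomial.aeval f (p n)) ω| ≤ 2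
    rw [e, abs_le]
    constructor <;> linarith
  · have e : ∀ n, (Polynomial.aeval f (p n)) ω = (p n).eval (f ω) := fun n => by
      simp
    simp only [e]
    have hlim : Tendsto (fun n : ℕ => min (1 : ℝ) (n * max (f ω - a) 0)) atTop
        (𝓝 (({ω | a < f ω} : Set Ω).indicator 1 ω)) := by
      by_cases hω : a < f ω
      · rw [indicator_of_mem (by exact hω)]
        have : Tendsto (fun n : ℕ => (n : ℝ) * max (f ω - a) 0) atTop atTop :=
          tendsto_natCast_atTop_atTop.atTop_mul_const (by simp [hω])
        refine tendsto_const_nhds.congr' ?_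
        filter_upwards [this.eventually_ge_atTop 1] with n hn
        simp [hn]
      · rw [indicator_of_notMem (by exact hω), max_eq_right (by linarith)]
        simp
    have hdiff : Tendsto (fun n : ℕ => (p n).eval (f ω) - min 1 (n * max (f ω - a) 0)) atTop
        (𝓝 0) :=
      squeeze_zero_norm (fun n => (key n ω).le) tendsto_one_div_add_atTop_nhds_zero_nat
    simpa using hdiff.add hlim

variable [mΩ : MeasurableSpace Ω]

/-- A set of measurable functions with values in `[0, 1]` that is closed under multiplication and
generates the σ-algebra. -/
structure IsMultiplicativeClass (C : Submonoid (Ω → ℝ)) : Prop where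
  measurable : ∀ f ∈ C, Measurable f
  mem_Icc : ∀ f ∈ C, ∀ ω, f ω ∈ Icc (0 : ℝ) 1
  le : ∀ m : MeasurableSpace Ω, (∀ f ∈ C, Measurable[m] f) → mΩ ≤ m

namespace IsMultiplicativeClass

variable {C : Submonoid (Ω → ℝ)}

/-- As C is a submonoid, the algebra it generates is its linear span, so q needs no product step.
Measurability and boundedness are carried along to make integrals additive. -/
theorem adjoin_induction (hC : IsMultiplicativeClass C) {q : (Ω → ℝ) → Prop}
    (mem : ∀ f ∈ C, q f) (zero : q 0)
    (add : ∀ f g, Measurable f → Measurable g → (∃ M, ∀ ω, |f ω| ≤ M) → (∃ M, ∀ ω, |g ω| ≤ M) →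
      q f → q g → q (f + g))
    (smul : ∀ (c : ℝ) f, q f → q (c • f)) :
    ∀ f ∈ Algebra.adjoin ℝ (C : Set (Ω → ℝ)), Measurable f ∧ (∃ M, ∀ ω, |f ω| ≤ M) ∧ q f := by
  intro f hf
  rw [← Subalgebra.mem_toSubmodule, Algebra.adjoin_eq_span, Submonoid.closure_eq] at hf
  induction hf using Submodule.span_induction with
  | mem f hf =>
    refine ⟨hC.measurable f hf, ⟨1, fun ω => ?_⟩, mem f hf⟩
    rw [abs_of_nonneg (hC.mem_Icc f hf ω).1]
    exact (hC.mem_Icc f hf ω).2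
  | zero => exact ⟨measurable_zero, ⟨0, by simp⟩, zero⟩
  | add f g _ _ hf hg =>
    obtain ⟨hfm, ⟨M, hM⟩, hfq⟩ := hf
    obtain ⟨hgm, ⟨N, hN⟩, hgq⟩ := hg
    exact ⟨hfm.add hgm, ⟨M + N, fun ω => (abs_add_le _ _).trans (add_le_add (hM ω) (hN ω))⟩,
      add f g hfm hgm ⟨M, hM⟩ ⟨N, hN⟩ hfq hgq⟩
  | smul c f _ hf =>
    obtain ⟨hfm, ⟨M, hM⟩, hfq⟩ := hf
    refine ⟨hfm.const_smul c, ⟨|c| * M, fun ω => ?_⟩, smul c f hfq⟩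
    rw [Pi.smul_apply, smul_eq_mul, abs_mul]
    exact mul_le_mul_of_nonneg_left (hM ω) (abs_nonneg c)

theorem measurable_of_mem (hC : IsMultiplicativeClass C) {f : Ω → ℝ}
    (hf : f ∈ Algebra.adjoin ℝ (C : Set (Ω → ℝ))) : Measurable f :=
  (hC.adjoin_induction (q := fun _ => True) (by simp) trivial (by simp) (by simp) f hf).1

theorem measurableSet (hC : IsMultiplicativeClass C) {S : Set Ω}
    (hS : IsBoundedLimit (Algebra.adjoin ℝ (C : Set (Ω → ℝ))) S) : MeasurableSet S := by
  obtain ⟨g, hg, -, hlim⟩ := hS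
  have hm : Measurable (S.indicator (1 : Ω → ℝ)) :=
    measurable_of_tendsto_metrizable (fun n => hC.measurable_of_mem (hg n))
      (tendsto_pi_nhds.2 hlim)
  exact (measurable_indicator_const_iff (1 : ℝ)).1 hm

/-- Superlevel sets of members of C are bounded limits, so every f ∈ C is measurable for the
σ-algebra generated by this π-system. -/
theorem eq_generateFrom (hC : IsMultiplicativeClass C) :
    mΩ = MeasurableSpace.generateFrom
      {S | IsBoundedLimit (Algebra.adjoin ℝ (C : Set (Ω → ℝ))) S} := by
  refine le_antisymm (hC.le _ fun f hf => ?_) (MeasurableSpace.generateFrom_le fun S hS =>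
    hC.measurableSet hS)
  refine @measurable_of_Ioi ℝ Ω _ _ _ (_) _ _ _ _ fun a => ?_
  exact MeasurableSpace.measurableSet_generateFrom
    (isBoundedLimit_lt (Algebra.subset_adjoin hf) (hC.mem_Icc f hf) a)

theorem tendsto_integral (hC : IsMultiplicativeClass C) (μ : Measure Ω) [IsFiniteMeasure μ]
    {S : Set Ω} {g : ℕ → Ω → ℝ} (hg : ∀ n, g n ∈ Algebra.adjoin ℝ (C : Set (Ω → ℝ)))
    {M : ℝ} (hM : ∀ n ω, |g n ω| ≤ M) (hS : MeasurableSet S)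
    (hlim : ∀ ω, Tendsto (fun n => g n ω) atTop (𝓝 (S.indicator 1 ω))) :
    Tendsto (fun n => ∫ ω, g n ω ∂μ) atTop (𝓝 (μ.real S)) := by
  rw [← integral_indicator_one hS]
  exact tendsto_integral_of_dominated_convergence (fun _ => M)
    (fun n => (hC.measurable_of_mem (hg n)).aestronglyMeasurable) (integrable_const M)
    (fun n => ae_of_all _ fun ω => hM n ω) (ae_of_all _ hlim)

theorem integrable (μ : Measure Ω) [IsFiniteMeasure μ] {f : Ω → ℝ} (hf : Measurable f)
    (hb : ∃ M, ∀ ω, |f ω| ≤ M) : Integrable f μ := by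
  obtain ⟨M, hM⟩ := hb
  exact Integrable.of_bound hf.aestronglyMeasurable M (ae_of_all _ hM)

/-- Probability measures that agree on a multiplicative class are equal. -/
theorem ext (hC : IsMultiplicativeClass C) {μ ν : Measure Ω} [IsProbabilityMeasure μ]
    [IsProbabilityMeasure ν] (h : ∀ f ∈ C, ∫ ω, f ω ∂μ = ∫ ω, f ω ∂ν) : μ = ν := by
  have h' := hC.adjoin_induction (q := fun f => ∫ ω, f ω ∂μ = ∫ ω, f ω ∂ν) h (by simp)
    (fun f g hf hg hfb hgb hfq hgq => by
      simp only [Pi.add_apply]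
      rw [integral_add (integrable μ hf hfb) (integrable μ hg hgb),
        integral_add (integrable ν hf hfb) (integrable ν hg hgb), hfq, hgq])
    (fun c f hf => by simp only [Pi.smul_apply, integral_smul, hf])
  -- Equality of integrals extends linearly to the algebra, then by dominated convergence to the
  -- π-system.
  refine MeasureTheory.ext_of_generate_finite _ hC.eq_generateFrom (isPiSystem_isBoundedLimit _)
    (fun S hS => ?_) (by simp)
  have hSm := hC.measurableSet hS
  obtain ⟨g, hg, ⟨M, hM⟩, hlim⟩ := hS
  have h1 := hC.tendsto_integral μ hg hM hSm hlim
  have h2 := hC.tendsto_integral ν hg hM hSm hlim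
  simp only [fun n => (h' _ (hg n)).2.2] at h1
  exact (measureReal_eq_measureReal_iff).1 (tendsto_nhds_unique h1 h2)

/-- A family of probability measures is measurable if its integrals of the functions in a
multiplicative class are. -/
theorem measurable_measure (hC : IsMultiplicativeClass C) {Ω' : Type*} [MeasurableSpace Ω']
    {κ : Ω' → Measure Ω} [∀ x, IsProbabilityMeasure (κ x)]
    (h : ∀ f ∈ C, Measurable fun x => ∫ ω, f ω ∂κ x) : Measurable κ := by
  have h' := hC.adjoin_induction (q := fun f => Measurable fun x => ∫ ω, f ω ∂κ x) h (by simp)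
    (fun f g hf hg hfb hgb hfq hgq => by
      have : (fun x => ∫ ω, (f + g) ω ∂κ x) = fun x => ∫ ω, f ω ∂κ x + ∫ ω, g ω ∂κ x := by
        ext x
        exact integral_add (integrable _ hf hfb) (integrable _ hg hgb)
      rw [this]
      exact hfq.add hgq)
    (fun c f hf => by
      simp only [Pi.smul_apply, integral_smul]
      exact hf.const_smul c)
  refine Measurable.measure_of_isPiSystem_of_isProbabilityMeasure hC.eq_generateFrom
    (isPiSystem_isBoundedLimit _) fun S hS => ?_
  have hSm := hC.measurableSet hS
  obtain ⟨g, hg, ⟨M, hM⟩, hlim⟩ := hS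
  have : Measurable fun x => (κ x).real S :=
    measurable_of_tendsto_metrizable (fun n => (h' _ (hg n)).2.2)
      (tendsto_pi_nhds.2 fun x => hC.tendsto_integral (κ x) hg hM hSm hlim)
  simpa [measureReal_def] using this.ennreal_ofReal

end IsMultiplicativeClass

end MultiplicativeClass

end ThinThick

namespace ThinThick

/-! ### Sums over injective tuples -/

/-- Induction on n, peeling off the first coordinate. Once the others are placed, it may be any
index of S (c 0) not yet used; by disjointness the used ones are exactly those whose label is c 0.
-/
theorem tsum_embedding_prod_indicator {ι : Type*} {m : ℕ} {S : Fin m → Set ι}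
    (hS : Pairwise fun i j => Disjoint (S i) (S j)) (n : ℕ) (c : Fin n → Fin m) :
    ∑' e : Fin n ↪ ι, ∏ k, (S (c k)).indicator (1 : ι → ℝ≥0∞) (e k) =
      ∏ i, fallingFactorial (∑' a, (S i).indicator 1 a) (Finset.univ.filter (c · = i)).card := by
  classical
  induction n with
  | zero => simp [fallingFactorial]
  | succ n ih =>
    set t : Fin m → ℝ≥0∞ := fun i => ∑' a, (S i).indicator 1 a with ht
    set N : Fin m → ℕ := fun i => (Finset.univ.filter fun k : Fin n => c k.succ = i).card with hN
    have hrhs : ∏ i, fallingFactorial (t i) (Finset.univ.filter (c · = i)).card =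
        (∏ i, fallingFactorial (t i) (N i)) * (t (c 0) - N (c 0)) := by
      have : ∀ i, fallingFactorial (t i) (Finset.univ.filter (c · = i)).card =
          fallingFactorial (t i) (N i) * if c 0 = i then t i - N i else 1 := by
        intro i
        rw [Fin.card_filter_univ_succ]
        split_ifs with h
        · rw [fallingFactorial, Finset.prod_range_succ]
          rfl
        · rw [mul_one]
      rw [Finset.prod_congr rfl fun i _ => this i, Finset.prod_mul_distrib,
        Finset.prod_ite_eq, if_pos (Finset.mem_univ _)]
    rw [hrhs, ← ih (fun k => c k.succ), ← ENNReal.tsum_mul_right,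
      ← (Equiv.embeddingFinSucc n ι).symm.tsum_eq, ENNReal.tsum_sigma']
    refine tsum_congr fun e => ?_
    simp only [Equiv.coe_embeddingFinSucc_symm, Fin.prod_univ_succ, Fin.cons_zero, Fin.cons_succ]
    rw [ENNReal.tsum_mul_right, mul_comm]
    by_cases he : ∀ k, e k ∈ S (c k.succ)
    · congr 1
      have hsplit : t (c 0) = ∑' a : range e, (S (c 0)).indicator (1 : ι → ℝ≥0∞) a +
          ∑' a : ((range e)ᶜ : Set ι), (S (c 0)).indicator (1 : ι → ℝ≥0∞) a :=
        (ENNReal.summable.tsum_add_tsum_compl ENNReal.summable).symm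
      have hrange : ∑' a : range e, (S (c 0)).indicator (1 : ι → ℝ≥0∞) a = N (c 0) := by
        rw [tsum_range (fun a => (S (c 0)).indicator (1 : ι → ℝ≥0∞) a) e.injective, tsum_fintype,
          hN]
        beta_reduce
        rw [Finset.card_filter, Nat.cast_sum]
        refine Finset.sum_congr rfl fun k _ => ?_
        by_cases hk : c k.succ = c 0
        · have h := he k
          rw [hk] at h
          simp [hk, h]
        · have : e k ∉ S (c 0) := fun h => (hS hk).le_bot ⟨he k, h⟩
          simp [hk, this]
      rw [hrange] at hsplit
      -- The subtraction is legitimate even if the total is ∞, because the number removed is finite.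
      exact ENNReal.eq_sub_of_add_eq (by simp) ((add_comm _ _).trans hsplit.symm)
    · push Not at he
      obtain ⟨k, hk⟩ := he
      have : ∏ k, (S (c k.succ)).indicator (1 : ι → ℝ≥0∞) (e k) = 0 :=
        Finset.prod_eq_zero (Finset.mem_univ k) (by simp [hk])
      simp [this]

/-- Embeddings are grouped by their image; an n-element set is the image of n! of them. -/
theorem tsum_embedding_prod {ι : Type*} (n : ℕ) (g : ι → ℝ≥0∞) :
    ∑' e : Fin n ↪ ι, ∏ k, g (e k) =
      ∑' t : Finset ι, if t.card = n then (n.factorial : ℝ≥0∞) * ∏ j ∈ t, g j else 0 := by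
  classical
  let φ : (Fin n ↪ ι) → Finset ι := fun e => Finset.univ.map e
  rw [← (Equiv.sigmaFiberEquiv φ).tsum_eq, ENNReal.tsum_sigma']
  refine tsum_congr fun t => ?_
  have h : ∀ e : {e // φ e = t}, ∏ k, g (Equiv.sigmaFiberEquiv φ ⟨t, e⟩ k) = ∏ j ∈ t, g j := by
    rintro ⟨e, rfl⟩
    simp [φ]
  simp only [h]
  split_ifs with hn
  · have e : {e // φ e = t} ≃ (Fin n ↪ t) :=
      { toFun := fun e => ⟨fun k => ⟨e.1 k,
          e.2.subset (Finset.mem_map_of_mem e.1 (Finset.mem_univ k))⟩, fun a b hab =>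
          e.1.injective (by simpa using hab)⟩
        invFun := fun e => ⟨e.trans (Function.Embedding.subtype _), by
          refine Finset.eq_of_subset_of_card_le (fun x hx => ?_) (by simp [φ, hn])
          obtain ⟨k, rfl⟩ : ∃ k, (e k : ι) = x := by simpa [φ] using hx
          exact (e k).2⟩
        left_inv := fun e => by ext; rfl
        right_inv := fun e => by ext; rfl }
    rw [e.tsum_eq (fun _ => ∏ j ∈ t, g j), tsum_fintype, Finset.sum_const, Finset.card_univ,
      Fintype.card_embedding_eq]
    simp [hn, Nat.descFactorial_self]
  · have : IsEmpty {e // φ e = t} := ⟨fun e => hn (by rw [← e.2]; simp [φ])⟩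
    simp

theorem tsum_embedding_prod_of_support {ι : Type*} (n : ℕ) {g : ι → ℝ≥0∞} {J : Finset ι}
    (hg : ∀ j ∉ J, g j = 0) :
    ∑' e : Fin n ↪ ι, ∏ k, g (e k) =
      n.factorial * ∑ t ∈ J.powersetCard n, ∏ j ∈ t, g j := by
  classical
  rw [tsum_embedding_prod, tsum_eq_sum (s := J.powersetCard n), Finset.mul_sum]
  · refine Finset.sum_congr rfl fun t ht => ?_
    rw [if_pos (Finset.mem_powersetCard.1 ht).2]
  · intro t ht
    split_ifs with hn
    · obtain ⟨j, hj, hjJ⟩ : ∃ j ∈ t, j ∉ J := by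
        by_contra! h
        exact ht (Finset.mem_powersetCard.2 ⟨h, hn⟩)
      rw [Finset.prod_eq_zero hj (hg j hjJ), mul_zero]
    · rfl

/-- The product is expanded over subsets of J, sorted by cardinality; terms with n > |J| vanish. -/
theorem hasSum_prod_one_sub {ι : Type*} {f : ι → ℝ} (h0 : ∀ j, 0 ≤ f j) {J : Finset ι}
    (hf : ∀ j ∉ J, f j = 0) :
    HasSum (fun n : ℕ => (-1) ^ n / (n.factorial : ℝ) *
      (∑' e : Fin n ↪ ι, ∏ k, ENNReal.ofReal (f (e k))).toReal) (∏ j ∈ J, (1 - f j)) := by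
  classical
  have h : ∀ n : ℕ, (-1) ^ n / (n.factorial : ℝ) *
      (∑' e : Fin n ↪ ι, ∏ k, ENNReal.ofReal (f (e k))).toReal =
        ∑ t ∈ J.powersetCard n, (-1) ^ t.card * ∏ j ∈ t, f j := by
    intro n
    rw [tsum_embedding_prod_of_support n (g := fun j => ENNReal.ofReal (f j)) (J := J)
      (fun j hj => by simp [hf j hj]), ENNReal.toReal_mul, ENNReal.toReal_sum
      (fun t _ => ENNReal.prod_ne_top fun j _ => ENNReal.ofReal_ne_top), Finset.mul_sum,
      Finset.mul_sum]
    refine Finset.sum_congr rfl fun t ht => ?_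
    rw [(Finset.mem_powersetCard.1 ht).2, ENNReal.toReal_prod]
    simp only [ENNReal.toReal_natCast, ENNReal.toReal_ofReal (h0 _)]
    have : (n.factorial : ℝ) ≠ 0 := by positivity
    field_simp
  simp only [h]
  have hprod : ∏ j ∈ J, (1 - f j) = ∑ n ∈ Finset.range (J.card + 1),
      ∑ t ∈ J.powersetCard n, (-1) ^ t.card * ∏ j ∈ t, f j := by
    rw [← Finset.sum_powerset]
    simp only [sub_eq_add_neg, Finset.prod_one_add, Finset.prod_neg]
  rw [hprod]
  refine hasSum_sum_of_ne_finset_zero fun n hn => ?_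
  rw [Finset.powersetCard_eq_empty.2 (by simpa using hn), Finset.sum_empty]

/-! ### Laplace transforms of multiplicity laws -/

section

variable {X : Type*} (p : Measure ℕ) [IsProbabilityMeasure p]

theorem integral_infinitePi_prod {ι : Type*} (J : Finset ι) (g : ι → ℕ → ℝ) :
    ∫ n, ∏ j ∈ J, g j (n j) ∂Measure.infinitePi (fun _ : ι => p) =
      ∏ j ∈ J, ∫ k, g j k ∂p := by
  have h := integral_restrict_infinitePi (μ := fun _ : ι => p) (s := J)
    (f := fun y : J → ℕ => ∏ j : J, g j (y j)) (measurable_of_countable _).aestronglyMeasurable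
  rw [integral_fintype_prod_eq_prod (fun (j : J) k => g j k),
    Finset.prod_coe_sort J fun j => ∫ k, g j k ∂p] at h
  rw [← h]
  refine integral_congr_ae (ae_of_all _ fun n => ?_)
  exact (Finset.prod_coe_sort J fun j => g j (n j)).symm

/-- `-log 𝔼 [exp (-m f)]`, where `m` has law `p`. -/
noncomputable def multiplicityTransform (f : X → ℝ) (x : X) : ℝ :=
  -Real.log (∫ k : ℕ, Real.exp (-(k * f x)) ∂p)

theorem integrable_exp_neg_mul {t : ℝ} (ht : 0 ≤ t) :
    Integrable (fun k : ℕ => Real.exp (-(k * t))) p := by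
  refine Integrable.of_bound (measurable_of_countable _).aestronglyMeasurable 1
    (ae_of_all _ fun k => ?_)
  rw [Real.norm_eq_abs, Real.abs_exp, Real.exp_le_one_iff]
  exact neg_nonpos.2 (by positivity)

theorem integral_exp_neg_mul_pos {t : ℝ} (ht : 0 ≤ t) :
    0 < ∫ k : ℕ, Real.exp (-(k * t)) ∂p :=
  integral_exp_pos (integrable_exp_neg_mul p ht)

theorem exp_neg_multiplicityTransform {f : X → ℝ} {x : X} (hx : 0 ≤ f x) :
    Real.exp (-multiplicityTransform p f x) = ∫ k : ℕ, Real.exp (-(k * f x)) ∂p := by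
  rw [multiplicityTransform, neg_neg, Real.exp_log (integral_exp_neg_mul_pos p hx)]

theorem integral_exp_neg_mul_anti {s t : ℝ} (hs : 0 ≤ s) (hst : s ≤ t) :
    ∫ k : ℕ, Real.exp (-(k * t)) ∂p ≤ ∫ k : ℕ, Real.exp (-(k * s)) ∂p :=
  integral_mono (integrable_exp_neg_mul p (hs.trans hst)) (integrable_exp_neg_mul p hs)
    fun k => Real.exp_le_exp.2 (neg_le_neg (by gcongr))

theorem multiplicityTransform_of_eq_zero {f : X → ℝ} {x : X} (hx : f x = 0) :
    multiplicityTransform p f x = 0 := by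
  simp [multiplicityTransform, hx]

end

end ThinThick

namespace ThinThick

/-! ### Test functions and their integrals against configurations -/

variable {X : Type*} [MetricSpace X] [MeasurableSpace X]

variable (X) in
/-- The bounded non-negative measurable functions with bounded support. -/
def testFunctions : AddSubmonoid (X → ℝ) where
  carrier := {f | Measurable f ∧ (∀ x, 0 ≤ f x) ∧ (∃ M, ∀ x, f x ≤ M) ∧
    Bornology.IsBounded (Function.support f)}
  zero_mem' := ⟨measurable_zero, fun _ => le_rfl, ⟨0, fun _ => le_rfl⟩, by simp⟩
  add_mem' := by
    rintro f g ⟨hf, hf0, ⟨M, hM⟩, hfb⟩ ⟨hg, hg0, ⟨N, hN⟩, hgb⟩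
    exact ⟨hf.add hg, fun x => add_nonneg (hf0 x) (hg0 x),
      ⟨M + N, fun x => add_le_add (hM x) (hN x)⟩,
      (hfb.union hgb).subset (Function.support_add f g)⟩

variable (X) in
/-- `CcPos X` as an additive submonoid. -/
def ccPos : AddSubmonoid (X → ℝ) where
  carrier := CcPos X
  zero_mem' := ⟨continuous_zero, HasCompactSupport.zero, fun _ => le_rfl⟩
  add_mem' := by
    rintro f g ⟨hf, hf', hf0⟩ ⟨hg, hg', hg0⟩
    exact ⟨hf.add hg, hf'.add hg', fun x => add_nonneg (hf0 x) (hg0 x)⟩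

theorem ccPos_le [BorelSpace X] : ccPos X ≤ testFunctions X := by
  rintro f ⟨hf, hf', hf0⟩
  obtain ⟨M, hM⟩ := hf.bounded_above_of_compact_support hf'
  exact ⟨hf.measurable, hf0, ⟨M, fun x => (le_abs_self _).trans (hM x)⟩,
    hf'.isBounded.subset (subset_tsupport f)⟩

theorem indicator_mem_testFunctions {B : Set X} (hB : MeasurableSet B)
    (hb : Bornology.IsBounded B) : B.indicator 1 ∈ testFunctions X :=
  ⟨measurable_one.indicator hB, fun _ => indicator_nonneg (fun _ _ => zero_le_one) _,
    ⟨1, fun _ => indicator_le_self' (fun _ _ => zero_le_one) _⟩,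
    hb.subset support_indicator_subset⟩

theorem multiplicityTransform_mem (p : Measure ℕ) [IsProbabilityMeasure p] {f : X → ℝ}
    (hf : f ∈ testFunctions X) :
    multiplicityTransform p f ∈ testFunctions X := by
  obtain ⟨hm, h0, ⟨M, hM⟩, hb⟩ := hf
  -- The transform is monotone in the value of f, so its value at the bound M bounds it.
  refine ⟨?_, fun x => ?_, ⟨-Real.log (∫ k : ℕ, Real.exp (-(k * M)) ∂p), fun x => ?_⟩,
    hb.subset fun x hx hx0 => hx (multiplicityTransform_of_eq_zero p hx0)⟩
  · have : StronglyMeasurable fun x => ∫ k : ℕ, Real.exp (-(k * f x)) ∂p := by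
      refine StronglyMeasurable.integral_prod_right' (f := fun z : X × ℕ =>
        Real.exp (-(z.2 * f z.1))) (Measurable.stronglyMeasurable ?_)
      exact (((measurable_of_countable (fun k : ℕ => (k : ℝ))).comp measurable_snd).mul
        (hm.comp measurable_fst)).neg.exp
    exact (Real.measurable_log.comp this.measurable).neg
  · refine neg_nonneg.2 (Real.log_nonpos (integral_exp_neg_mul_pos p (h0 x)).le ?_)
    simpa using integral_exp_neg_mul_anti p le_rfl (h0 x)
  · exact neg_le_neg (Real.log_le_log (integral_exp_neg_mul_pos p ((h0 x).trans (hM x)))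
      (integral_exp_neg_mul_anti p (h0 x) (hM x)))

namespace CountingMeasure

theorem measurable_toMeasure : Measurable (toMeasure : CountingMeasure X → Measure X) :=
  measurable_subtype_coe

theorem toMeasure_apply (ξ : CountingMeasure X) {B : Set X} (hB : MeasurableSet B) :
    ξ.toMeasure B = ∑' j, B.indicator 1 (ξ.point j) := by
  rw [ξ.toMeasure_eq_sum_dirac, Measure.sum_apply _ hB]
  simp [Measure.dirac_apply' _ hB]

theorem lintegral_toMeasure (ξ : CountingMeasure X) {g : X → ℝ≥0∞} (hg : Measurable g) :
    ∫⁻ x, g x ∂ξ.toMeasure = ∑' j, g (ξ.point j) := by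
  rw [ξ.toMeasure_eq_sum_dirac, lintegral_sum_measure]
  simp [lintegral_dirac' _ hg]

theorem integral_eq_toReal (ξ : CountingMeasure X) {f : X → ℝ} (hf : f ∈ testFunctions X) :
    ∫ x, f x ∂ξ.toMeasure = (∫⁻ x, ENNReal.ofReal (f x) ∂ξ.toMeasure).toReal :=
  integral_eq_lintegral_of_nonneg_ae (ae_of_all _ hf.2.1) hf.1.aestronglyMeasurable

theorem integral_toMeasure (ξ : CountingMeasure X) {f : X → ℝ}
    (hf : f ∈ testFunctions X) {J : Finset ξ.index} (hJ : ∀ j ∉ J, f (ξ.point j) = 0) :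
    ∫ x, f x ∂ξ.toMeasure = ∑ j ∈ J, f (ξ.point j) := by
  rw [integral_eq_toReal _ hf, lintegral_toMeasure _ hf.1.ennreal_ofReal,
    tsum_eq_sum (s := J) fun j hj => by simp [hJ j hj],
    ENNReal.toReal_sum fun j _ => ENNReal.ofReal_ne_top]
  simp [hf.2.1]

theorem measurable_integral {f : X → ℝ} (hf : f ∈ testFunctions X) :
    Measurable fun ξ : CountingMeasure X => ∫ x, f x ∂ξ.toMeasure := by
  simp only [integral_eq_toReal _ hf]
  exact ((Measure.measurable_lintegral hf.1.ennreal_ofReal).comp measurable_toMeasure).ennreal_toReal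

variable [BorelSpace X]

theorem finite_point_mem (ξ : CountingMeasure X) {B : Set X} (hB : Bornology.IsBounded B) :
    {j | ξ.point j ∈ B}.Finite := by
  have hm : MeasurableSet (closure B) := isClosed_closure.measurableSet
  have hfin : ξ.toMeasure (closure B) < ∞ := ξ.2.2 _ hB.closure
  rw [ξ.toMeasure_apply hm] at hfin
  refine (ENNReal.finite_const_le_of_tsum_ne_top hfin.ne one_ne_zero).subset fun j hj => ?_
  have : ξ.point j ∈ closure B := subset_closure hj
  simp [this]

/-- The indices of the points at which `f` does not vanish. -/
noncomputable def activeIndex (ξ : CountingMeasure X) {f : X → ℝ} (hf : f ∈ testFunctions X) :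
    Finset ξ.index :=
  (ξ.finite_point_mem hf.2.2.2).toFinset

theorem eq_zero_of_notMem_activeIndex (ξ : CountingMeasure X) {f : X → ℝ}
    (hf : f ∈ testFunctions X) : ∀ j ∉ ξ.activeIndex hf, f (ξ.point j) = 0 := fun j hj => by
  simpa [activeIndex] using hj

theorem lintegral_withMultiplicity (ξ : CountingMeasure X) (n : ξ.index → ℕ) {g : X → ℝ≥0∞}
    (hg : Measurable g) :
    ∫⁻ x, g x ∂(ξ.withMultiplicity n).toMeasure = ∑' j, n j * g (ξ.point j) := by
  change ∫⁻ x, g x ∂(Measure.sum fun j => (n j : ℝ≥0∞) • Measure.dirac (ξ.point j)) = _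
  rw [lintegral_sum_measure]
  simp [lintegral_dirac' _ hg]

theorem integral_withMultiplicity (ξ : CountingMeasure X) (n : ξ.index → ℕ) {f : X → ℝ}
    (hf : f ∈ testFunctions X) {J : Finset ξ.index} (hJ : ∀ j ∉ J, f (ξ.point j) = 0) :
    ∫ x, f x ∂(ξ.withMultiplicity n).toMeasure = ∑ j ∈ J, n j * f (ξ.point j) := by
  rw [integral_eq_toReal _ hf, lintegral_withMultiplicity _ _ hf.1.ennreal_ofReal,
    tsum_eq_sum (s := J) fun j hj => by simp [hJ j hj],
    ENNReal.toReal_sum fun j _ => ENNReal.mul_ne_top (by simp) (by simp)]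
  simp [hf.2.1]

theorem integrable_toMeasure (ξ : CountingMeasure X) {f : X → ℝ} (hf : f ∈ testFunctions X) :
    Integrable f ξ.toMeasure := by
  refine ⟨hf.1.aestronglyMeasurable, ?_⟩
  rw [hasFiniteIntegral_iff_ofReal (ae_of_all _ hf.2.1),
    lintegral_toMeasure _ hf.1.ennreal_ofReal, tsum_eq_sum (s := ξ.activeIndex hf) fun j hj => by
      simp [ξ.eq_zero_of_notMem_activeIndex hf j hj]]
  exact ENNReal.sum_lt_top.2 fun j _ => ENNReal.ofReal_lt_top

end CountingMeasure

/-- The functional `ξ ↦ exp (-∫ f dξ)`. -/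
noncomputable def expNeg (f : X → ℝ) (ξ : CountingMeasure X) : ℝ := Real.exp (-∫ x, f x ∂ξ.toMeasure)

theorem measurable_expNeg {f : X → ℝ} (hf : f ∈ testFunctions X) : Measurable (expNeg f) :=
  (CountingMeasure.measurable_integral hf).neg.exp

theorem expNeg_mem_Icc {f : X → ℝ} (hf : f ∈ testFunctions X) (ξ : CountingMeasure X) :
    expNeg f ξ ∈ Icc (0 : ℝ) 1 :=
  ⟨(Real.exp_pos _).le, Real.exp_le_one_iff.2 (neg_nonpos.2 (integral_nonneg hf.2.1))⟩

theorem laplace_nonneg (P : Measure (CountingMeasure X)) (f : X → ℝ) : 0 ≤ laplace P f :=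
  integral_nonneg fun _ => (Real.exp_pos _).le

theorem ofReal_laplace (P : Measure (CountingMeasure X)) [IsProbabilityMeasure P] {f : X → ℝ}
    (hf : f ∈ testFunctions X) :
    ENNReal.ofReal (laplace P f) = ∫⁻ ξ, ENNReal.ofReal (expNeg f ξ) ∂P :=
  ofReal_integral_eq_lintegral_ofReal
    (IsMultiplicativeClass.integrable _ (measurable_expNeg hf)
      ⟨1, fun ξ => abs_le.2 ⟨(neg_nonpos.2 zero_le_one).trans (expNeg_mem_Icc hf ξ).1,
        (expNeg_mem_Icc hf ξ).2⟩⟩)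
    (ae_of_all _ fun ξ => (expNeg_mem_Icc hf ξ).1)

variable [BorelSpace X]

/-- The functionals `ξ ↦ exp (-∫ f dξ)`, `f ∈ T`. -/
def laplaceClass (T : AddSubmonoid (X → ℝ)) (hT : T ≤ testFunctions X) :
    Submonoid (CountingMeasure X → ℝ) where
  carrier := {F | ∃ f ∈ T, F = expNeg f}
  one_mem' := ⟨0, T.zero_mem, by ext; simp [expNeg]⟩
  mul_mem' := by
    rintro _ _ ⟨f, hf, rfl⟩ ⟨g, hg, rfl⟩
    refine ⟨f + g, T.add_mem hf hg, ?_⟩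
    ext ξ
    simp only [expNeg, Pi.mul_apply, Pi.add_apply]
    rw [integral_add (ξ.integrable_toMeasure (hT hf)) (ξ.integrable_toMeasure (hT hg)), neg_add,
      Real.exp_add]

/-- A logarithm recovers ∫ f dξ from the functional, so generation of the σ-algebra reduces to
recovering the evaluations ξ(B) from these integrals. -/
theorem isMultiplicativeClass_laplaceClass (T : AddSubmonoid (X → ℝ)) (hT : T ≤ testFunctions X)
    (h : ∀ m : MeasurableSpace (CountingMeasure X),
      (∀ f ∈ T, Measurable[m] fun ξ => ∫ x, f x ∂ξ.toMeasure) →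
        ∀ B : Set X, MeasurableSet B → Measurable[m] fun ξ => ξ.toMeasure B) :
    IsMultiplicativeClass (laplaceClass T hT) where
  measurable := by
    rintro _ ⟨f, hf, rfl⟩
    exact measurable_expNeg (hT hf)
  mem_Icc := by
    rintro _ ⟨f, hf, rfl⟩
    exact expNeg_mem_Icc (hT hf)
  le := by
    intro m hm
    have h' := h m fun f hf => by
      have : (fun ξ : CountingMeasure X => ∫ x, f x ∂ξ.toMeasure) =
          fun ξ => -Real.log (expNeg f ξ) := by
        ext ξ
        simp [expNeg]
      rw [this]
      exact (Real.measurable_log.comp (hm _ ⟨f, hf, rfl⟩)).neg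
    have h2 : Measurable[m] (CountingMeasure.toMeasure (X := X)) :=
      Measure.measurable_of_measurable_coe _ h'
    rintro _ ⟨S, hS, rfl⟩
    exact h2 hS

theorem isMultiplicativeClass_testFunctions :
    IsMultiplicativeClass (laplaceClass (testFunctions X) le_rfl) := by
  refine isMultiplicativeClass_laplaceClass _ _ fun m hm B hB => ?_
  rcases isEmpty_or_nonempty X with hX | ⟨⟨x₀⟩⟩
  · simp only [Measure.eq_zero_of_isEmpty]
    exact measurable_const
  have hmono : Monotone fun n : ℕ => B ∩ Metric.closedBall x₀ n := fun a b hab =>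
    inter_subset_inter_right _ (Metric.closedBall_subset_closedBall (by exact_mod_cast hab))
  have hU : ⋃ n : ℕ, B ∩ Metric.closedBall x₀ n = B := by
    rw [← inter_iUnion, Metric.iUnion_closedBall_nat, inter_univ]
  -- B is exhausted by bounded pieces, which have finite mass, so that real integrals lose nothing.
  have : (fun ξ : CountingMeasure X => ξ.toMeasure B) =
      fun ξ => ⨆ n : ℕ, ENNReal.ofReal
        (∫ x, (B ∩ Metric.closedBall x₀ n).indicator 1 x ∂ξ.toMeasure) := by
    ext ξ
    rw [← hU, hmono.measure_iUnion]
    refine iSup_congr fun n => ?_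
    rw [hU, integral_indicator_one (hB.inter Metric.isClosed_closedBall.measurableSet),
      measureReal_def, ENNReal.ofReal_toReal]
    exact (ξ.2.2 _ (Metric.isBounded_closedBall.subset inter_subset_right)).ne
  rw [this]
  exact Measurable.iSup fun n => (hm _ (indicator_mem_testFunctions
    (hB.inter Metric.isClosed_closedBall.measurableSet)
    (Metric.isBounded_closedBall.subset inter_subset_right))).ennreal_ofReal

/-! ### Random multiplicities -/

theorem measurable_withMultiplicity (ξ : CountingMeasure X) :
    Measurable ξ.withMultiplicity := by
  refine Measurable.subtype_mk (Measure.measurable_of_measurable_coe _ fun B hB => ?_)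
  simp only [Measure.sum_apply _ hB, Measure.smul_apply, smul_eq_mul]
  refine Measurable.tsum fun j => Measurable.mul_const ?_ _
  exact (measurable_of_countable (fun k : ℕ => (k : ℝ≥0∞))).comp (measurable_pi_apply j)

variable (p : Measure ℕ) [IsProbabilityMeasure p]

instance (ξ : CountingMeasure X) : IsProbabilityMeasure (multiplicityLaw p ξ) :=
  Measure.isProbabilityMeasure_map (measurable_withMultiplicity ξ).aemeasurable

/-- Only finitely many points see f, so independence factors the expectation over them. -/
theorem integral_expNeg_multiplicityLaw {f : X → ℝ} (hf : f ∈ testFunctions X)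
    (ξ : CountingMeasure X) :
    ∫ η, expNeg f η ∂multiplicityLaw p ξ = expNeg (multiplicityTransform p f) ξ := by
  set J := ξ.activeIndex hf
  have hJ := ξ.eq_zero_of_notMem_activeIndex hf
  rw [multiplicityLaw, integral_map (measurable_withMultiplicity ξ).aemeasurable
    (measurable_expNeg hf).aestronglyMeasurable]
  have h1 : ∀ n : ξ.index → ℕ, expNeg f (ξ.withMultiplicity n) =
      ∏ j ∈ J, Real.exp (-(n j * f (ξ.point j))) := by
    intro n
    rw [expNeg, ξ.integral_withMultiplicity n hf hJ, ← Finset.sum_neg_distrib, Real.exp_sum]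
  simp only [h1]
  rw [integral_infinitePi_prod p J fun j k => Real.exp (-(k * f (ξ.point j))),
    expNeg, ξ.integral_toMeasure (multiplicityTransform_mem p hf) (J := J) fun j hj =>
      multiplicityTransform_of_eq_zero p (hJ j hj), ← Finset.sum_neg_distrib, Real.exp_sum]
  exact Finset.prod_congr rfl fun j _ => (exp_neg_multiplicityTransform p (hf.2.1 _)).symm

/-- The enumeration of the points is an arbitrary choice, with no measurability in ξ. The Laplace
functionals of the law do not depend on it and are measurable in ξ, which suffices. -/
theorem measurable_multiplicityLaw :
    Measurable (multiplicityLaw p : CountingMeasure X → Measure (CountingMeasure X)) := by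
  refine isMultiplicativeClass_testFunctions.measurable_measure ?_
  rintro _ ⟨f, hf, rfl⟩
  simp only [integral_expNeg_multiplicityLaw p hf]
  exact measurable_expNeg (multiplicityTransform_mem p hf)

theorem isProbabilityMeasure_randomMultiplicity (P : Measure (CountingMeasure X))
    [IsProbabilityMeasure P] : IsProbabilityMeasure (randomMultiplicity p P) :=
  isProbabilityMeasure_bind (measurable_multiplicityLaw p).aemeasurable
    (ae_of_all _ fun _ => inferInstance)

theorem laplace_randomMultiplicity (P : Measure (CountingMeasure X)) [IsProbabilityMeasure P]
    {f : X → ℝ} (hf : f ∈ testFunctions X) :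
    laplace (randomMultiplicity p P) f = laplace P (multiplicityTransform p f) := by
  have := isProbabilityMeasure_randomMultiplicity p P
  rw [← ENNReal.ofReal_eq_ofReal_iff (laplace_nonneg _ _) (laplace_nonneg _ _),
    ofReal_laplace _ hf, ofReal_laplace _ (multiplicityTransform_mem p hf), randomMultiplicity,
    Measure.lintegral_bind (measurable_multiplicityLaw p).aemeasurable
      (measurable_expNeg hf).ennreal_ofReal.aemeasurable]
  refine lintegral_congr fun ξ => ?_
  rw [← integral_expNeg_multiplicityLaw p hf]
  exact (ofReal_laplace (multiplicityLaw p ξ) hf).symm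

end ThinThick

namespace ThinThick

/-! ### Factorial moments -/

theorem measurable_fallingFactorial (k : ℕ) : Measurable fun t => fallingFactorial t k :=
  Finset.measurable_prod _ fun _ _ => measurable_id.sub_const _

theorem measurableSet_box {X : Type*} [MeasurableSpace X] {n m : ℕ} {A : Fin m → Set X}
    (hA : ∀ i, MeasurableSet (A i)) (c : Fin n → Fin m) :
    MeasurableSet {x : Fin n → X | ∀ k, x k ∈ A (c k)} := by
  simp only [ofPred_forall]
  exact MeasurableSet.iInter fun k => measurable_pi_apply k (hA _)

/-- The product of the values of a simple function is a combination of indicators of boxes. -/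
theorem exists_prod_simpleFunc_eq {X : Type*} [MeasurableSpace X] (f : SimpleFunc X ℝ≥0∞) :
    ∃ (m : ℕ) (A : Fin m → Set X) (a : Fin m → ℝ≥0∞), (∀ i, MeasurableSet (A i)) ∧
      (Pairwise fun i j => Disjoint (A i) (A j)) ∧
      ∀ (n : ℕ) (ν : Measure (Fin n → X)), ∫⁻ x, ∏ k, f (x k) ∂ν =
        ∑ c : Fin n → Fin m, (∏ k, a (c k)) * ν {x | ∀ k, x k ∈ A (c k)} := by
  classical
  let e := f.range.equivFin
  let a : Fin f.range.card → ℝ≥0∞ := fun i => (e.symm i : ℝ≥0∞)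
  have ha : Function.Injective a := Subtype.val_injective.comp e.symm.injective
  have hA : ∀ i, MeasurableSet (f ⁻¹' {a i}) := fun i => f.measurableSet_fiber _
  refine ⟨f.range.card, fun i => f ⁻¹' {a i}, a, hA, fun i j hij => ?_, fun n ν => ?_⟩
  · refine Set.disjoint_left.2 fun x hi hj => hij (ha ?_)
    exact (mem_singleton_iff.1 hi).symm.trans (mem_singleton_iff.1 hj)
  have hf : ∀ x, f x = ∑ i, if f x = a i then a i else 0 := by
    intro x
    rw [Finset.sum_eq_single (e ⟨f x, f.mem_range_self x⟩)]
    · simp [a]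
    · intro i _ hi
      refine if_neg fun h => hi ?_
      apply ha
      simpa [a] using h.symm
    · simp
  have hprod : ∀ x : Fin n → X, ∏ k, f (x k) = ∑ c : Fin n → Fin f.range.card,
      (∏ k, a (c k)) * {x : Fin n → X | ∀ k, x k ∈ f ⁻¹' {a (c k)}}.indicator 1 x := by
    intro x
    rw [Finset.prod_congr rfl fun k _ => hf (x k), Finset.prod_univ_sum, Fintype.piFinset_univ]
    refine Finset.sum_congr rfl fun c _ => ?_
    by_cases h : ∀ k, f (x k) = a (c k)
    · rw [indicator_of_mem (by exact h)]
      simp [h]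
    · rw [indicator_of_notMem (by exact h), mul_zero]
      push Not at h
      obtain ⟨k, hk⟩ := h
      exact Finset.prod_eq_zero (Finset.mem_univ k) (if_neg hk)
  simp only [hprod]
  rw [lintegral_finsetSum _ fun c _ =>
    (measurable_one.indicator (measurableSet_box hA c)).const_mul _]
  refine Finset.sum_congr rfl fun c _ => ?_
  rw [lintegral_const_mul _ (measurable_one.indicator (measurableSet_box hA c)),
    lintegral_indicator_one (measurableSet_box hA c)]

/-- Monotone convergence; finiteness of f excludes 0 · ∞ in the limit of the product. -/
theorem tendsto_lintegral_prod_eapprox {X : Type*} [MeasurableSpace X] {n : ℕ} {f : X → ℝ≥0∞}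
    (hf : Measurable f) (hf' : ∀ x, f x ≠ ∞) (ν : Measure (Fin n → X)) :
    Filter.Tendsto (fun N => ∫⁻ x, ∏ k, SimpleFunc.eapprox f N (x k) ∂ν) Filter.atTop
      (nhds (∫⁻ x, ∏ k, f (x k) ∂ν)) := by
  refine lintegral_tendsto_of_tendsto_of_monotone (fun N => ?_) (ae_of_all _ fun x => ?_)
    (ae_of_all _ fun x => ?_)
  · exact (Finset.measurable_prod _ fun k _ =>
      (SimpleFunc.measurable _).comp (measurable_pi_apply k)).aemeasurable
  · intro M N h
    exact Finset.prod_le_prod' fun k _ => SimpleFunc.monotone_eapprox f h (x k)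
  · exact ENNReal.tendsto_finsetProd_of_ne_top _ (fun k _ => SimpleFunc.tendsto_eapprox hf (x k))
      fun k _ => hf' (x k)

variable {X : Type*} [MetricSpace X] [MeasurableSpace X]

namespace CountingMeasure

/-- The `n`-th factorial measure: the sum of the point masses at the `n`-tuples of points of `ξ`
with distinct indices. -/
noncomputable def factorialMeasure (n : ℕ) (ξ : CountingMeasure X) : Measure (Fin n → X) :=
  Measure.sum fun e : Fin n ↪ ξ.index => Measure.dirac fun k => ξ.point (e k)

theorem lintegral_factorialMeasure (n : ℕ) (ξ : CountingMeasure X) {g : (Fin n → X) → ℝ≥0∞}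
    (hg : Measurable g) :
    ∫⁻ x, g x ∂ξ.factorialMeasure n = ∑' e : Fin n ↪ ξ.index, g fun k => ξ.point (e k) := by
  simp [factorialMeasure, lintegral_sum_measure, lintegral_dirac' _ hg]

/-- This identifies the factorial moments defining correlation functions with expected masses of
boxes. -/
theorem factorialMeasure_box (ξ : CountingMeasure X) {n m : ℕ} {A : Fin m → Set X}
    (hA : ∀ i, MeasurableSet (A i)) (hd : Pairwise fun i j => Disjoint (A i) (A j))
    (c : Fin n → Fin m) :
    ξ.factorialMeasure n {x | ∀ k, x k ∈ A (c k)} =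
      ∏ i, fallingFactorial (ξ.toMeasure (A i)) (Finset.univ.filter (c · = i)).card := by
  classical
  have h := tsum_embedding_prod_indicator (S := fun i => ξ.point ⁻¹' A i)
    (fun i j hij => (hd hij).preimage _) n c
  have hb := measurableSet_box hA c
  rw [← lintegral_indicator_one hb, lintegral_factorialMeasure _ _ (measurable_one.indicator hb)]
  simp only [toMeasure_apply _ (hA _)]
  refine Eq.trans (tsum_congr fun e => ?_) h
  simp only [indicator_apply, mem_ofPred_eq, Pi.one_apply, mem_preimage, Finset.prod_ite_zero,
    Finset.prod_const_one, Finset.mem_univ, forall_true_left]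

theorem measurable_factorialMeasure_box {n m : ℕ} {A : Fin m → Set X}
    (hA : ∀ i, MeasurableSet (A i)) (hd : Pairwise fun i j => Disjoint (A i) (A j))
    (c : Fin n → Fin m) :
    Measurable fun ξ : CountingMeasure X =>
      ξ.factorialMeasure n {x | ∀ k, x k ∈ A (c k)} := by
  simp only [factorialMeasure_box _ hA hd]
  exact Finset.measurable_prod _ fun i _ => (measurable_fallingFactorial _).comp
    ((Measure.measurable_coe (hA i)).comp measurable_toMeasure)

theorem measurable_lintegral_prod_simpleFunc (n : ℕ) (f : SimpleFunc X ℝ≥0∞) :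
    Measurable fun ξ : CountingMeasure X => ∫⁻ x, ∏ k, f (x k) ∂ξ.factorialMeasure n := by
  obtain ⟨m, A, a, hA, hd, h⟩ := exists_prod_simpleFunc_eq f
  simp only [h]
  exact Finset.measurable_sum _ fun c _ => (measurable_factorialMeasure_box hA hd c).const_mul _

theorem measurable_lintegral_prod (n : ℕ) {f : X → ℝ≥0∞} (hf : Measurable f)
    (hf' : ∀ x, f x ≠ ∞) :
    Measurable fun ξ : CountingMeasure X => ∫⁻ x, ∏ k, f (x k) ∂ξ.factorialMeasure n :=
  measurable_of_tendsto_metrizable (fun _ => measurable_lintegral_prod_simpleFunc n _)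
    (tendsto_pi_nhds.2 fun ξ => tendsto_lintegral_prod_eapprox hf hf' (ξ.factorialMeasure n))

end CountingMeasure

/-- Campbell's formula for factorial moments. -/
theorem lintegral_lintegral_factorialMeasure {l : Measure X} {P : Measure (CountingMeasure X)}
    {n : ℕ} {ρ : (Fin n → X) → ℝ≥0} (hρ : IsCorrelationFunction l P ρ) {f : X → ℝ≥0∞}
    (hf : Measurable f) (hf' : ∀ x, f x ≠ ∞) :
    ∫⁻ ξ, ∫⁻ x, ∏ k, f (x k) ∂ξ.factorialMeasure n ∂P =
      ∫⁻ x, ∏ k, f (x k) ∂(Measure.pi fun _ => l).withDensity fun x => (ρ x : ℝ≥0∞) := by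
  -- All factors being the same s, the boxes have fibres of s as sides. Any two sides are equal or
  -- disjoint, just as the definition of a correlation function requires.
  have hs : ∀ s : SimpleFunc X ℝ≥0∞, ∫⁻ ξ, ∫⁻ x, ∏ k, s (x k) ∂ξ.factorialMeasure n ∂P =
      ∫⁻ x, ∏ k, s (x k) ∂(Measure.pi fun _ => l).withDensity fun x => (ρ x : ℝ≥0∞) := by
    intro s
    obtain ⟨m, A, a, hA, hd, h⟩ := exists_prod_simpleFunc_eq s
    simp only [h]
    rw [lintegral_finsetSum _ fun c _ =>
      (CountingMeasure.measurable_factorialMeasure_box hA hd c).const_mul _]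
    refine Finset.sum_congr rfl fun c _ => ?_
    rw [lintegral_const_mul _ (CountingMeasure.measurable_factorialMeasure_box hA hd c),
      withDensity_apply _ (measurableSet_box hA c), ← hρ.2 m A hA hd c]
    simp only [CountingMeasure.factorialMeasure_box _ hA hd]
  refine tendsto_nhds_unique (lintegral_tendsto_of_tendsto_of_monotone
    (fun N => (CountingMeasure.measurable_lintegral_prod_simpleFunc n
      (SimpleFunc.eapprox f N)).aemeasurable) (ae_of_all _ fun ξ _ _ hMN => ?_)
      (ae_of_all _ fun ξ => tendsto_lintegral_prod_eapprox hf hf' _)) ?_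
  · exact lintegral_mono fun x =>
      Finset.prod_le_prod' fun k _ => SimpleFunc.monotone_eapprox f hMN (x k)
  · simp only [hs]
    exact tendsto_lintegral_prod_eapprox hf hf' _

/-! ### Thinning and correlation functions -/

variable [BorelSpace X]

theorem ae_eq_zero_or_one (α : I) {ι : Type*} [Countable ι] :
    ∀ᵐ n ∂Measure.infinitePi fun _ : ι => bernoulliMeasure (1 : ℕ) 0 α,
      ∀ j, n j = 0 ∨ n j = 1 := by
  rw [ae_all_iff]
  intro j
  have h : ∀ᵐ k ∂bernoulliMeasure (1 : ℕ) 0 α, k = 0 ∨ k = 1 := by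
    rw [ae_iff, bernoulliMeasure_apply_of_notMem_of_notMem] <;> simp
  exact (measurePreserving_eval_infinitePi (fun _ : ι => bernoulliMeasure (1 : ℕ) 0 α)
    j).quasiMeasurePreserving.ae h

theorem infinitePi_forall_embedding_eq_one (α : I) {ι : Type*} {n : ℕ} (e : Fin n ↪ ι) :
    (Measure.infinitePi fun _ : ι => bernoulliMeasure (1 : ℕ) 0 α) {y | ∀ k, y (e k) = 1} =
      ((unitInterval.toNNReal α : ℝ≥0) : ℝ≥0∞) ^ n := by
  classical
  have : {y : ι → ℕ | ∀ k, y (e k) = 1} =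
      Set.pi (Finset.univ.map e : Finset ι) fun _ => {1} := by
    ext y
    simp [Set.mem_pi]
  rw [this, Measure.infinitePi_pi _ fun _ _ => measurableSet_singleton _, Finset.prod_const]
  simp [bernoulliMeasure_def]

/-- Almost surely every multiplicity is 0 or 1, so the factorial moment counts n-tuples of distinct
surviving indices; each tuple survives with probability α^n. -/
theorem lintegral_thinning_prod_fallingFactorial (α : I) (ξ : CountingMeasure X) {n m : ℕ}
    {A : Fin m → Set X} (hA : ∀ i, MeasurableSet (A i))
    (hd : Pairwise fun i j => Disjoint (A i) (A j)) (c : Fin n → Fin m) :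
    ∫⁻ η, ∏ i, fallingFactorial (η.toMeasure (A i)) (Finset.univ.filter (c · = i)).card
        ∂multiplicityLaw (bernoulliMeasure (1 : ℕ) 0 α) ξ =
      ((unitInterval.toNNReal α : ℝ≥0) : ℝ≥0∞) ^ n *
        ∏ i, fallingFactorial (ξ.toMeasure (A i)) (Finset.univ.filter (c · = i)).card := by
  classical
  have hmeas : Measurable fun η : CountingMeasure X =>
      ∏ i, fallingFactorial (η.toMeasure (A i)) (Finset.univ.filter (c · = i)).card :=
    Finset.measurable_prod _ fun i _ => (measurable_fallingFactorial _).comp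
      ((Measure.measurable_coe (hA i)).comp CountingMeasure.measurable_toMeasure)
  rw [multiplicityLaw, lintegral_map hmeas (measurable_withMultiplicity ξ)]
  have key : ∀ᵐ y ∂Measure.infinitePi fun _ : ξ.index => bernoulliMeasure (1 : ℕ) 0 α,
      ∏ i, fallingFactorial ((ξ.withMultiplicity y).toMeasure (A i))
        (Finset.univ.filter (c · = i)).card =
      ∑' e : Fin n ↪ ξ.index, {y : ξ.index → ℕ | ∀ k, y (e k) = 1}.indicator 1 y *
        ∏ k, (ξ.point ⁻¹' A (c k)).indicator 1 (e k) := by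
    filter_upwards [ae_eq_zero_or_one α] with y hy
    have h := tsum_embedding_prod_indicator
      (S := fun i => {j | y j = 1} ∩ ξ.point ⁻¹' A i)
      (fun i j hij => ((hd hij).preimage _).mono inter_subset_right inter_subset_right) n c
    have h1 : ∀ i, (ξ.withMultiplicity y).toMeasure (A i) =
        ∑' j, ({j | y j = 1} ∩ ξ.point ⁻¹' A i).indicator 1 j := by
      intro i
      rw [← lintegral_indicator_one (hA i),
        ξ.lintegral_withMultiplicity y (measurable_one.indicator (hA i))]
      refine tsum_congr fun j => ?_
      rcases hy j with hj | hj <;> simp [indicator_apply, hj]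
    simp only [h1]
    rw [← h]
    refine tsum_congr fun e => ?_
    have h2 : {y : ξ.index → ℕ | ∀ k, y (e k) = 1}.indicator (1 : (ξ.index → ℕ) → ℝ≥0∞) y =
        ∏ k, {j | y j = 1}.indicator 1 (e k) := by
      simp only [indicator_apply, mem_ofPred_eq, Pi.one_apply, Finset.prod_ite_zero,
        Finset.prod_const_one, Finset.mem_univ, forall_true_left]
    rw [h2, ← Finset.prod_mul_distrib]
    exact Finset.prod_congr rfl fun k _ => by rw [inter_indicator_one]; rfl
  have hset : ∀ e : Fin n ↪ ξ.index, MeasurableSet {y : ξ.index → ℕ | ∀ k, y (e k) = 1} := by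
    intro e
    simp only [ofPred_forall]
    exact MeasurableSet.iInter fun k => measurable_pi_apply (e k) (measurableSet_singleton 1)
  have : Countable (Fin n ↪ ξ.index) := DFunLike.coe_injective.countable
  rw [lintegral_congr_ae key, lintegral_tsum fun e =>
    ((measurable_one.indicator (hset e)).mul_const _).aemeasurable]
  have h3 : ∀ e : Fin n ↪ ξ.index, ∫⁻ y, {y : ξ.index → ℕ | ∀ k, y (e k) = 1}.indicator 1 y *
        ∏ k, (ξ.point ⁻¹' A (c k)).indicator 1 (e k)
          ∂Measure.infinitePi (fun _ : ξ.index => bernoulliMeasure (1 : ℕ) 0 α) =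
      ((unitInterval.toNNReal α : ℝ≥0) : ℝ≥0∞) ^ n *
        ∏ k, (ξ.point ⁻¹' A (c k)).indicator 1 (e k) := by
    intro e
    rw [lintegral_mul_const _ (measurable_one.indicator (hset e)),
      lintegral_indicator_one (hset e), infinitePi_forall_embedding_eq_one]
  simp only [h3]
  rw [ENNReal.tsum_mul_left]
  congr 1
  rw [tsum_embedding_prod_indicator (S := fun i => ξ.point ⁻¹' A i)
    (fun i j hij => (hd hij).preimage _) n c]
  simp only [CountingMeasure.toMeasure_apply _ (hA _)]
  rfl

theorem isCorrelationFunction_thinned {l : Measure X} {P : Measure (CountingMeasure X)} {n : ℕ}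
    {ρ : (Fin n → X) → ℝ≥0} (hρ : IsCorrelationFunction l P ρ) (α : I) :
    IsCorrelationFunction l (thinned α P) fun x => unitInterval.toNNReal α ^ n * ρ x := by
  refine ⟨hρ.1.const_mul _, fun m A hA hd c => ?_⟩
  have hmeas : Measurable fun η : CountingMeasure X =>
      ∏ i, fallingFactorial (η.toMeasure (A i)) (Finset.univ.filter (c · = i)).card :=
    Finset.measurable_prod _ fun i _ => (measurable_fallingFactorial _).comp
      ((Measure.measurable_coe (hA i)).comp CountingMeasure.measurable_toMeasure)
  rw [thinned, randomMultiplicity,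
    Measure.lintegral_bind (measurable_multiplicityLaw _).aemeasurable hmeas.aemeasurable]
  simp only [lintegral_thinning_prod_fallingFactorial α _ hA hd c, ENNReal.coe_mul,
    ENNReal.coe_pow]
  rw [lintegral_const_mul _ hmeas, lintegral_const_mul _ hρ.1.coe_nnreal_ennreal,
    hρ.2 m A hA hd c]

theorem isDeterminantal_thinned {l : Measure X} {K : X → X → ℂ} {P : Measure (CountingMeasure X)}
    (hP : IsDeterminantal l K P) (α : I) :
    IsDeterminantal l (fun x y => (α : ℂ) * K x y) (thinned α P) where
  isProbabilityMeasure :=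
    have := hP.isProbabilityMeasure
    isProbabilityMeasure_randomMultiplicity _ P
  measurable_kernel := hP.measurable_kernel.const_mul _
  correlation n := by
    obtain ⟨ρ, hρ, hdet⟩ := hP.correlation n
    refine ⟨_, isCorrelationFunction_thinned hρ α, ?_⟩
    filter_upwards [hdet] with x hx
    have : (Matrix.of fun i j : Fin n => (α : ℂ) * K (x i) (x j)) =
        (α : ℂ) • Matrix.of fun i j : Fin n => K (x i) (x j) := rfl
    rw [this, Matrix.det_smul, ← hx]
    simp

end ThinThick

namespace ThinThick

/-! ### Fredholm expansions of Laplace functionals -/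

theorem HasFredholmDet.unique {X : Type*} [MeasurableSpace X] {l : Measure X} {T : X → X → ℂ} {d d' : ℂ}
    (h : HasFredholmDet l T d) (h' : HasFredholmDet l T d') : d = d' :=
  HasSum.unique h.2 h'.2

/-- Rows scale by f and columns by the indicator, which f absorbs because it vanishes off A. -/
theorem det_cutKernel {X : Type*} {f : X → ℝ} {A : Set X} (hA : Function.support f ⊆ A) (K : X → X → ℂ)
    {n : ℕ} (x : Fin n → X) :
    (Matrix.of fun i j => cutKernel f K A (x i) (x j)).det =
      (∏ k, (f (x k) : ℂ)) * (Matrix.of fun i j => K (x i) (x j)).det := by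
  have h1 : (Matrix.of fun i j => cutKernel f K A (x i) (x j)) =
      Matrix.of fun i j => A.indicator (1 : X → ℂ) (x j) *
        (Matrix.of fun i j => (f (x i) : ℂ) * K (x i) (x j)) i j := by
    ext i j
    simp [cutKernel, mul_comm]
  have h2 : (Matrix.of fun i j => (f (x i) : ℂ) * K (x i) (x j)) =
      Matrix.of fun i j => (f (x i) : ℂ) * (Matrix.of fun i j => K (x i) (x j)) i j := rfl
  rw [h1, Matrix.det_mul_row, h2, Matrix.det_mul_column, ← mul_assoc, ← Finset.prod_mul_distrib]
  congr 1
  refine Finset.prod_congr rfl fun k _ => ?_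
  by_cases hk : x k ∈ A
  · simp [hk]
  · have : f (x k) = 0 := by
      by_contra h
      exact hk (hA h)
    simp [this]

variable {X : Type*} [MetricSpace X] [MeasurableSpace X]

/-- The `n`-th factorial moment `𝔼 [∑ ∏ f (x j)]`, the sum being over the `n`-tuples of distinct
points. -/
noncomputable def factorialMoment (P : Measure (CountingMeasure X)) (f : X → ℝ) (n : ℕ) : ℝ≥0∞ :=
  ∫⁻ ξ, ∫⁻ x, ∏ k, ENNReal.ofReal (f (x k)) ∂ξ.factorialMeasure n ∂P

theorem factorialMoment_mono (P : Measure (CountingMeasure X)) {f g : X → ℝ} (h : ∀ x, f x ≤ g x)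
    (n : ℕ) : factorialMoment P f n ≤ factorialMoment P g n :=
  lintegral_mono fun _ => lintegral_mono fun _ =>
    Finset.prod_le_prod' fun _ _ => ENNReal.ofReal_le_ofReal (h _)

variable {l : Measure X} {K : X → X → ℂ} {P : Measure (CountingMeasure X)} {f : X → ℝ} {A : Set X}

theorem factorialMoment_eq {n : ℕ} {ρ : (Fin n → X) → ℝ≥0} (hρ : IsCorrelationFunction l P ρ)
    (hf : Measurable f) (h0 : ∀ x, 0 ≤ f x) :
    factorialMoment P f n =
      ∫⁻ x, ENNReal.ofReal ((∏ k, f (x k)) * ρ x) ∂(Measure.pi fun _ => l) := by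
  have hm : Measurable fun x : Fin n → X => ∏ k, ENNReal.ofReal (f (x k)) :=
    Finset.measurable_prod _ fun k _ => (hf.comp (measurable_pi_apply k)).ennreal_ofReal
  rw [factorialMoment, lintegral_lintegral_factorialMeasure hρ hf.ennreal_ofReal
    fun _ => ENNReal.ofReal_ne_top,
    lintegral_withDensity_eq_lintegral_mul _ hρ.1.coe_nnreal_ennreal hm]
  refine lintegral_congr fun x => ?_
  rw [Pi.mul_apply, mul_comm, ENNReal.ofReal_mul (Finset.prod_nonneg fun k _ => h0 _),
    ENNReal.ofReal_prod_of_nonneg fun k _ => h0 _, ENNReal.ofReal_coe_nnreal]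

/-- The density ∏ f(x_k) · ρ is real and nonnegative, so the complex Fredholm integrals become
Lebesgue integrals equal to factorial moments. -/
theorem IsDeterminantal.exists_density (hP : IsDeterminantal l K P) (hf : Measurable f)
    (h0 : ∀ x, 0 ≤ f x) (hA : Function.support f ⊆ A) (n : ℕ) :
    ∃ g : (Fin n → X) → ℝ, Measurable g ∧ (∀ x, 0 ≤ g x) ∧
      ((fun x : Fin n → X => (Matrix.of fun i j => cutKernel f K A (x i) (x j)).det)
        =ᵐ[Measure.pi fun _ => l] fun x => (g x : ℂ)) ∧
      factorialMoment P f n = ∫⁻ x, ENNReal.ofReal (g x) ∂(Measure.pi fun _ => l) := by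
  obtain ⟨ρ, hρ, hdet⟩ := hP.correlation n
  refine ⟨fun x => (∏ k, f (x k)) * ρ x, (Finset.measurable_prod _ fun k _ =>
    hf.comp (measurable_pi_apply k)).mul hρ.1.coe_nnreal_real, fun x =>
      mul_nonneg (Finset.prod_nonneg fun k _ => h0 _) (ρ x).2, ?_, factorialMoment_eq hρ hf h0⟩
  filter_upwards [hdet] with x hx
  rw [det_cutKernel hA, ← hx]
  push_cast
  rfl

theorem IsDeterminantal.integrable_det_iff (hP : IsDeterminantal l K P) (hf : Measurable f)
    (h0 : ∀ x, 0 ≤ f x) (hA : Function.support f ⊆ A) (n : ℕ) :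
    Integrable (fun x : Fin n → X => (Matrix.of fun i j => cutKernel f K A (x i) (x j)).det)
      (Measure.pi fun _ => l) ↔ factorialMoment P f n ≠ ∞ := by
  obtain ⟨g, hg, hg0, hae, hE⟩ := hP.exists_density hf h0 hA n
  rw [integrable_congr hae, hE, ← lt_top_iff_ne_top,
    ← hasFiniteIntegral_iff_ofReal (ae_of_all _ hg0)]
  exact ⟨fun h => h.re.2, fun h => Integrable.ofReal ⟨hg.aestronglyMeasurable, h⟩⟩

theorem IsDeterminantal.integral_det (hP : IsDeterminantal l K P) (hf : Measurable f)
    (h0 : ∀ x, 0 ≤ f x) (hA : Function.support f ⊆ A) (n : ℕ) :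
    ∫ x : Fin n → X, (Matrix.of fun i j => cutKernel f K A (x i) (x j)).det
      ∂(Measure.pi fun _ => l) = ((factorialMoment P f n).toReal : ℂ) := by
  obtain ⟨g, hg, hg0, hae, hE⟩ := hP.exists_density hf h0 hA n
  rw [integral_congr_ae hae, integral_complex_ofReal, hE,
    integral_eq_lintegral_of_nonneg_ae (ae_of_all _ hg0) hg.aestronglyMeasurable]

/-- The exponential generating series of the factorial moments of `f` converges absolutely. -/
def HasSummableMoments (P : Measure (CountingMeasure X)) (f : X → ℝ) : Prop :=
  (∀ n, factorialMoment P f n ≠ ∞) ∧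
    Summable fun n : ℕ => (factorialMoment P f n).toReal / n.factorial

theorem HasSummableMoments.mono {g : X → ℝ} (h : HasSummableMoments P g)
    (hfg : ∀ x, f x ≤ g x) : HasSummableMoments P f := by
  refine ⟨fun n => ne_top_of_le_ne_top (h.1 n) (factorialMoment_mono P hfg n),
    h.2.of_nonneg_of_le (fun n => by positivity) fun n => ?_⟩
  gcongr
  exacts [h.1 n, factorialMoment_mono P hfg n]

/-- The n-th Fredholm term has modulus exactly the n-th factorial moment over n!. -/
theorem IsDeterminantal.hasSummableMoments (hP : IsDeterminantal l K P) (hf : Measurable f)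
    (h0 : ∀ x, 0 ≤ f x) (hA : Function.support f ⊆ A) {d : ℂ}
    (h : HasFredholmDet l (cutKernel f K A) d) : HasSummableMoments P f := by
  refine ⟨fun n => (hP.integrable_det_iff hf h0 hA n).1 (h.1 n), ?_⟩
  have := h.2.summable.norm
  simp only [hP.integral_det hf h0 hA] at this
  refine this.congr fun n => ?_
  simp [div_eq_inv_mul]

variable [BorelSpace X]

theorem expNeg_eq_prod {ψ : X → ℝ} (hψ : ψ ∈ testFunctions X) (ξ : CountingMeasure X) :
    expNeg ψ ξ = ∏ j ∈ ξ.activeIndex hψ, (1 - (1 - Real.exp (-ψ (ξ.point j)))) := by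
  rw [expNeg, ξ.integral_toMeasure hψ (ξ.eq_zero_of_notMem_activeIndex hψ),
    ← Finset.sum_neg_distrib, Real.exp_sum]
  simp

/-- The Laplace functional of a determinantal process is a Fredholm determinant. -/
theorem IsDeterminantal.hasFredholmDet_laplace (hP : IsDeterminantal l K P) {ψ : X → ℝ}
    (hψ : ψ ∈ testFunctions X) (hA : Function.support ψ ⊆ A)
    (hs : HasSummableMoments P fun x => 1 - Real.exp (-ψ x)) :
    HasFredholmDet l (cutKernel (fun x => 1 - Real.exp (-ψ x)) K A) (laplace P ψ) := by
  set f : X → ℝ := fun x => 1 - Real.exp (-ψ x) with hfdef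
  have hf : Measurable f := measurable_const.sub hψ.1.neg.exp
  have h0 : ∀ x, 0 ≤ f x := fun x =>
    sub_nonneg.2 (Real.exp_le_one_iff.2 (neg_nonpos.2 (hψ.2.1 x)))
  have hfA : Function.support f ⊆ A := fun x hx => hA fun h => hx (by simp [hfdef, h])
  refine ⟨fun n => (hP.integrable_det_iff hf h0 hfA n).2 (hs.1 n), ?_⟩
  let e : ℕ → CountingMeasure X → ℝ≥0∞ := fun n ξ =>
    ∫⁻ x, ∏ k, ENNReal.ofReal (f (x k)) ∂ξ.factorialMeasure n
  have he : ∀ n, Measurable (e n) := fun n =>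
    CountingMeasure.measurable_lintegral_prod n hf.ennreal_ofReal fun _ => ENNReal.ofReal_ne_top
  have hint : ∀ n, Integrable (fun ξ => (e n ξ).toReal) P := fun n =>
    integrable_toReal_of_lintegral_ne_top (he n).aemeasurable (hs.1 n)
  have hEq : ∀ n, ∫ ξ, (e n ξ).toReal ∂P = (factorialMoment P f n).toReal := fun n =>
    integral_toReal (he n).aemeasurable (ae_lt_top (he n) (hs.1 n))
  have hpt : ∀ ξ : CountingMeasure X,
      HasSum (fun n : ℕ => (-1) ^ n / (n.factorial : ℝ) * (e n ξ).toReal) (expNeg ψ ξ) := by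
    intro ξ
    rw [expNeg_eq_prod hψ]
    have := hasSum_prod_one_sub (f := fun j => f (ξ.point j)) (fun j => h0 _)
      (J := ξ.activeIndex hψ) fun j hj => by
        simp [hfdef, ξ.eq_zero_of_notMem_activeIndex hψ j hj]
    have hm : ∀ n, Measurable fun x : Fin n → X => ∏ k, ENNReal.ofReal (f (x k)) := fun n =>
      Finset.measurable_prod _ fun k _ => (hf.comp (measurable_pi_apply k)).ennreal_ofReal
    simpa only [e, ξ.lintegral_factorialMeasure _ (hm _)] using this
  -- Summability of the moments over n! permits exchanging expectation and the pointwise expansion.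
  have hsum := hasSum_integral_of_summable_integral_norm (μ := P)
    (F := fun (n : ℕ) ξ => (-1) ^ n / (n.factorial : ℝ) * (e n ξ).toReal)
    (fun n => (hint n).const_mul _) (by
      refine hs.2.congr fun n => ?_
      simp only [norm_mul, norm_div, norm_pow, norm_neg, norm_one, one_pow, RCLike.norm_natCast,
        Real.norm_of_nonneg ENNReal.toReal_nonneg]
      rw [integral_const_mul, hEq, one_div, div_eq_inv_mul])
  simp only [fun ξ => (hpt ξ).tsum_eq, integral_const_mul, hEq] at hsum
  simp only [hP.integral_det hf h0 hfA]
  have := Complex.hasSum_ofReal.2 hsum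
  simpa [laplace, expNeg] using this

end ThinThick

namespace ThinThick

/-! ### The Bernoulli and geometric transforms -/

theorem one_sub_exp_neg_multiplicityTransform_bernoulli {X : Type*} (α : I) {ψ : X → ℝ} {x : X}
    (hx : 0 ≤ ψ x) :
    1 - Real.exp (-multiplicityTransform (bernoulliMeasure (1 : ℕ) 0 α) ψ x) =
      α * (1 - Real.exp (-ψ x)) := by
  rw [exp_neg_multiplicityTransform _ hx, integral_bernoulliMeasure]
  simp
  ring

/-- A geometric series of ratio βe^{-t}; the numerator carries an extra e^{-t} because
multiplicities start at 1. -/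
theorem integral_exp_neg_mul_shiftedGeometric (β : I) (hβ : (β : ℝ) < 1) {t : ℝ} (ht : 0 ≤ t) :
    ∫ k : ℕ, Real.exp (-(k * t)) ∂shiftedGeometric β =
      (1 - β) * Real.exp (-t) / (1 - β * Real.exp (-t)) := by
  have hσ : σ β ≠ 0 := fun h => by
    have := congrArg Subtype.val h
    simp at this
    linarith
  have hint : Integrable (fun k : ℕ => Real.exp (-((k + 1 : ℕ) * t)))
      (geometricMeasure (σ β)) := by
    exact (integrable_map_measure (f := fun k : ℕ => k + 1)
      (g := fun k : ℕ => Real.exp (-(k * t))) (measurable_of_countable _).aestronglyMeasurable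
      (measurable_of_countable _).aemeasurable).1 (integrable_exp_neg_mul (shiftedGeometric β) ht)
  rw [shiftedGeometric, integral_map (measurable_of_countable _).aemeasurable
    (measurable_of_countable _).aestronglyMeasurable]
  refine (hasSum_integral_geometricMeasure hσ hint).unique ?_
  have hs : Real.exp (-t) ≤ 1 := Real.exp_le_one_iff.2 (neg_nonpos.2 ht)
  have h := (hasSum_geometric_of_lt_one (mul_nonneg β.2.1 (Real.exp_pos (-t)).le)
    ((mul_le_of_le_one_right β.2.1 hs).trans_lt hβ)).mul_left ((1 - (β : ℝ)) * Real.exp (-t))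
  rw [← div_eq_mul_inv] at h
  refine (congrArg (fun u => HasSum u _) (funext fun n => ?_)).mpr h
  have he : Real.exp (-((n + 1 : ℕ) * t)) = Real.exp (-t) ^ n * Real.exp (-t) := by
    rw [← Real.exp_nat_mul, ← Real.exp_add]
    push_cast
    ring_nf
  rw [he]
  simp [mul_pow]
  ring

theorem one_sub_exp_neg_multiplicityTransform_shiftedGeometric {X : Type*} (β : I)
    (hβ : (β : ℝ) < 1) {ψ : X → ℝ} {x : X} (hx : 0 ≤ ψ x) :
    1 - Real.exp (-multiplicityTransform (shiftedGeometric β) ψ x) =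
      (1 - Real.exp (-ψ x)) / (1 - β + β * (1 - Real.exp (-ψ x))) := by
  rw [exp_neg_multiplicityTransform _ hx, integral_exp_neg_mul_shiftedGeometric β hβ hx]
  have hs : Real.exp (-ψ x) ≤ 1 := Real.exp_le_one_iff.2 (neg_nonpos.2 hx)
  have h : 0 < 1 - β * Real.exp (-ψ x) :=
    sub_pos.2 ((mul_le_of_le_one_right β.2.1 hs).trans_lt hβ)
  have h' : 1 - (β : ℝ) + β * (1 - Real.exp (-ψ x)) = 1 - β * Real.exp (-ψ x) := by ring
  rw [h', one_sub_div h.ne']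
  ring

theorem support_multiplicityTransform_shiftedGeometric {X : Type*} (β : I)
    (hβ : (β : ℝ) < 1) {ψ : X → ℝ} (h0 : ∀ x, 0 ≤ ψ x) :
    Function.support (multiplicityTransform (shiftedGeometric β) ψ) = Function.support ψ := by
  refine Subset.antisymm (fun x hx hx0 => hx (multiplicityTransform_of_eq_zero _ hx0))
    fun x hx hx0 => ?_
  have h := one_sub_exp_neg_multiplicityTransform_shiftedGeometric β hβ (h0 x)
  have hs : Real.exp (-ψ x) < 1 :=
    Real.exp_lt_one_iff.2 (neg_neg_of_pos (lt_of_le_of_ne (h0 x) (Ne.symm hx)))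
  rw [hx0, neg_zero, Real.exp_zero, sub_self] at h
  have h' : 0 < 1 - (β : ℝ) + β * (1 - Real.exp (-ψ x)) :=
    add_pos_of_pos_of_nonneg (sub_pos.2 hβ) (mul_nonneg β.2.1 (sub_pos.2 hs).le)
  exact (div_pos (sub_pos.2 hs) h').ne h

/-- The closed form gives continuity, and β < 1 keeps the denominator positive. This makes the
convergence hypothesis applicable to the transform. -/
theorem multiplicityTransform_shiftedGeometric_mem {X : Type*} [TopologicalSpace X] (β : I)
    (hβ : (β : ℝ) < 1) {ψ : X → ℝ} (hψ : ψ ∈ CcPos X) :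
    multiplicityTransform (shiftedGeometric β) ψ ∈ CcPos X := by
  obtain ⟨hc, hs, h0⟩ := hψ
  have hsupp := support_multiplicityTransform_shiftedGeometric β hβ h0
  refine ⟨?_, ?_, fun x => neg_nonneg.2 (Real.log_nonpos
    (integral_exp_neg_mul_pos _ (h0 x)).le ?_)⟩
  · have hlt : ∀ x, 0 < 1 - β * Real.exp (-ψ x) := fun x =>
      sub_pos.2 ((mul_le_of_le_one_right β.2.1
        (Real.exp_le_one_iff.2 (neg_nonpos.2 (h0 x)))).trans_lt hβ)
    have : multiplicityTransform (shiftedGeometric β) ψ = fun x =>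
        -Real.log ((1 - β) * Real.exp (-ψ x) / (1 - β * Real.exp (-ψ x))) := by
      ext x
      rw [multiplicityTransform, integral_exp_neg_mul_shiftedGeometric β hβ (h0 x)]
    rw [this]
    refine (Continuous.log (Continuous.div (by fun_prop) (by fun_prop) fun x => (hlt x).ne')
      fun x => ?_).neg
    exact (div_pos (mul_pos (sub_pos.2 hβ) (Real.exp_pos _)) (hlt x)).ne'
  · rw [HasCompactSupport, tsupport, hsupp]
    exact hs
  · simpa using integral_exp_neg_mul_anti (shiftedGeometric β) le_rfl (h0 x)

/-! ### Continuous test functions generate the σ-algebra -/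

variable {X : Type*} [MetricSpace X] [MeasurableSpace X] [BorelSpace X]

/-- The indicator of C is the limit of thickened indicators of radius δ/(n+1). Local compactness
provides δ with compact closed thickening, so these are in `CcPos`, and the first one dominates the
others. -/
theorem measurable_real_of_isCompact [LocallyCompactSpace X] {m : MeasurableSpace (CountingMeasure X)}
    (hm : ∀ f ∈ ccPos X, Measurable[m] fun ξ => ∫ x, f x ∂ξ.toMeasure) {C : Set X}
    (hC : IsCompact C) : Measurable[m] fun ξ => ξ.toMeasure.real C := by
  obtain ⟨δ, hδ, hcpt⟩ := hC.exists_isCompact_cthickening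
  have hpos : ∀ n : ℕ, 0 < δ / (n + 1) := fun n => by positivity
  have hle : ∀ n : ℕ, δ / (n + 1) ≤ δ := fun n => div_le_self hδ.le (by simp)
  let f : ℕ → X → ℝ := fun n x => thickenedIndicator (hpos n) C x
  have hf : ∀ n, f n ∈ ccPos X := fun n => by
    refine ⟨by fun_prop, HasCompactSupport.intro hcpt fun x hx => ?_, fun x => NNReal.coe_nonneg _⟩
    have := thickenedIndicator_zero (hpos n) C
      fun h => hx (Metric.cthickening_mono (hle n) C (Metric.thickening_subset_cthickening _ _ h))
    exact congrArg NNReal.toReal this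
  have hlim : ∀ ξ : CountingMeasure X, Filter.Tendsto (fun n => ∫ x, f n x ∂ξ.toMeasure)
      Filter.atTop (nhds (ξ.toMeasure.real C)) := by
    intro ξ
    rw [← integral_indicator_one hC.measurableSet]
    refine tendsto_integral_of_dominated_convergence (f 0)
      (fun n => (hf n).1.aestronglyMeasurable) (ξ.integrable_toMeasure (ccPos_le (hf 0)))
      (fun n => ae_of_all _ fun x => ?_) (ae_of_all _ fun x => ?_)
    · rw [Real.norm_of_nonneg ((hf n).2.2 x)]
      exact NNReal.coe_le_coe.2 (thickenedIndicator_mono (hpos n) (hpos 0)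
        (by simpa using hle n) C x)
    · have hd : Filter.Tendsto (fun n : ℕ => δ / ((n : ℝ) + 1)) Filter.atTop (nhds 0) := by
        simpa [div_eq_mul_inv] using tendsto_one_div_add_atTop_nhds_zero_nat.const_mul δ
      have h := tendsto_pi_nhds.1 (thickenedIndicator_tendsto_indicator_closure hpos hd C) x
      rw [hC.isClosed.closure_eq] at h
      have hC1 : C.indicator (1 : X → ℝ) x = ((C.indicator (fun _ => 1) x : ℝ≥0) : ℝ) := by
        by_cases hx : x ∈ C <;> simp [hx]
      rw [hC1]
      exact (NNReal.continuous_coe.tendsto _).comp h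
  exact @measurable_of_tendsto_metrizable _ _ m _ _ _ _ _ _
    (fun n => hm _ (hf n)) (tendsto_pi_nhds.2 hlim)

/-- On each set of a compact exhaustion the restricted measures are finite, so closed sets suffice
as a π-system; their traces there are compact. -/
theorem isMultiplicativeClass_ccPos [LocallyCompactSpace X] [SecondCountableTopology X] :
    IsMultiplicativeClass (laplaceClass (ccPos X) ccPos_le) := by
  refine isMultiplicativeClass_laplaceClass _ _ fun m hm B hB => ?_
  have hfin : ∀ (ξ : CountingMeasure X) {C : Set X}, IsCompact C → ξ.toMeasure C ≠ ∞ :=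
    fun ξ C hC => (ξ.2.2 _ hC.isBounded).ne
  have hcpt : ∀ {C : Set X}, IsCompact C → Measurable[m] fun ξ => ξ.toMeasure C := fun {C} hC => by
    have := (measurable_real_of_isCompact hm hC).ennreal_ofReal
    simpa only [measureReal_def, ENNReal.ofReal_toReal (hfin _ hC)] using this
  have hN : ∀ N : ℕ, Measurable[m] fun ξ : CountingMeasure X =>
      ξ.toMeasure.restrict (compactCovering X N) := by
    intro N
    have hNc := isCompact_compactCovering X N
    have : ∀ ξ : CountingMeasure X,
        IsFiniteMeasure (ξ.toMeasure.restrict (compactCovering X N)) := fun ξ =>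
      ⟨by simpa using (hfin ξ hNc).lt_top⟩
    refine Measurable.measure_of_isPiSystem (S := {s | IsClosed s})
      ((‹BorelSpace X›.measurable_eq).trans borel_eq_generateFrom_isClosed) isPiSystem_isClosed
      (fun s hs => ?_) ?_
    · simp only [Measure.restrict_apply (IsClosed.measurableSet hs)]
      exact hcpt (hNc.inter_left hs)
    · simpa using hcpt hNc
  have : (fun ξ : CountingMeasure X => ξ.toMeasure B) =
      fun ξ => ⨆ N : ℕ, ξ.toMeasure.restrict (compactCovering X N) B := by
    ext ξ
    simp only [Measure.restrict_apply hB]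
    rw [← Monotone.measure_iUnion, ← inter_iUnion, iUnion_compactCovering, inter_univ]
    exact fun a b hab => inter_subset_inter_right _ (compactCovering_subset X hab)
  rw [this]
  exact Measurable.iSup fun N => (Measure.measurable_coe hB).comp (hN N)

/-- A point process on a locally compact space is determined by its Laplace functional. -/
theorem eq_of_laplace_eq [LocallyCompactSpace X] [SecondCountableTopology X]
    {P Q : Measure (CountingMeasure X)} [IsProbabilityMeasure P] [IsProbabilityMeasure Q]
    (h : ∀ ψ ∈ CcPos X, laplace P ψ = laplace Q ψ) : P = Q := by
  refine isMultiplicativeClass_ccPos.ext ?_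
  rintro _ ⟨ψ, hψ, rfl⟩
  exact h ψ hψ

/-! ### Thinned and thickened determinantal processes -/

variable {l : Measure X} {K : X → X → ℂ} {P : Measure (CountingMeasure X)}

theorem IsDeterminantal.hasSummableMoments_one_sub_exp (hP : IsDeterminantal l K P) {ψ : X → ℝ}
    (hψ : ψ ∈ CcPos X) {d : ℂ}
    (h : HasFredholmDet l (cutKernel (fun x => 1 - Real.exp (-ψ x)) K (tsupport ψ)) d) :
    HasSummableMoments P fun x => 1 - Real.exp (-ψ x) := by
  refine hP.hasSummableMoments (measurable_const.sub hψ.1.measurable.neg.exp) (fun x =>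
    sub_nonneg.2 (Real.exp_le_one_iff.2 (neg_nonpos.2 (hψ.2.2 x)))) (fun x hx => ?_) h
  exact subset_tsupport ψ fun h0 => hx (by simp [h0])

theorem IsDeterminantal.hasFredholmDet_laplace_thinned (hP : IsDeterminantal l K P) (α : I)
    {ψ : X → ℝ} (hψ : ψ ∈ CcPos X) {d : ℂ}
    (h : HasFredholmDet l (cutKernel (fun x => 1 - Real.exp (-ψ x)) K (tsupport ψ)) d) :
    HasFredholmDet l (cutKernel (fun x => 1 - Real.exp (-ψ x)) (fun x y => (α : ℂ) * K x y)
      (tsupport ψ)) (laplace (thinned α P) ψ) := by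
  have := hP.isProbabilityMeasure
  have hψ' : ψ ∈ testFunctions X := ccPos_le hψ
  have hT := fun x => one_sub_exp_neg_multiplicityTransform_bernoulli α (hψ.2.2 x)
  -- Moving α from the kernel into the function reduces the claim to the unthinned process.
  have hker : cutKernel (fun x => 1 - Real.exp (-ψ x)) (fun x y => (α : ℂ) * K x y) (tsupport ψ) =
      cutKernel (fun x => 1 - Real.exp
        (-multiplicityTransform (bernoulliMeasure (1 : ℕ) 0 α) ψ x)) K (tsupport ψ) := by
    ext x y
    simp only [cutKernel, hT]
    push_cast
    ring
  rw [hker, thinned, laplace_randomMultiplicity _ _ hψ']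
  refine hP.hasFredholmDet_laplace (multiplicityTransform_mem _ hψ') (fun x hx => ?_)
    ((hP.hasSummableMoments_one_sub_exp hψ h).mono fun x => ?_)
  · exact subset_tsupport ψ fun h0 => hx (multiplicityTransform_of_eq_zero _ h0)
  · rw [hT]
    exact mul_le_of_le_one_left
      (sub_nonneg.2 (Real.exp_le_one_iff.2 (neg_nonpos.2 (hψ.2.2 x)))) α.2.2

theorem IsDeterminantal.hasFredholmDet_laplace_thickened (hP : IsDeterminantal l K P) (β : I)
    (hβ : (β : ℝ) < 1)
    (h : ∀ ψ ∈ CcPos X, ∃ d : ℂ, HasFredholmDet l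
      (cutKernel (fun x => 1 - Real.exp (-ψ x)) K (tsupport ψ)) d)
    {ψ : X → ℝ} (hψ : ψ ∈ CcPos X) :
    HasFredholmDet l (cutKernel
      (fun x => (1 - Real.exp (-ψ x)) / (1 - β + β * (1 - Real.exp (-ψ x)))) K (tsupport ψ))
      (laplace (thickened β P) ψ) := by
  have := hP.isProbabilityMeasure
  have hTψ := multiplicityTransform_shiftedGeometric_mem β hβ hψ
  have hsupp : tsupport (multiplicityTransform (shiftedGeometric β) ψ) = tsupport ψ := by
    rw [tsupport, tsupport, support_multiplicityTransform_shiftedGeometric β hβ hψ.2.2]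
  -- The hypothesis is used at the transform of ψ, not at ψ.
  obtain ⟨d, hd⟩ := h _ hTψ
  rw [thickened, laplace_randomMultiplicity _ _ (ccPos_le hψ), ← hsupp]
  simp only [← fun x => one_sub_exp_neg_multiplicityTransform_shiftedGeometric β hβ (hψ.2.2 x)]
  exact hP.hasFredholmDet_laplace (ccPos_le hTψ) (subset_tsupport _)
    (hP.hasSummableMoments_one_sub_exp hTψ hd)

end ThinThick

theorem mainTheorem3 {X : Type*} [MetricSpace X] [CompleteSpace X] [SecondCountableTopology X]
    [MeasurableSpace X] [BorelSpace X] (l : Measure X) [SigmaFinite l] (K : X → X → ℂ)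
    (P : Measure (ThinThick.CountingMeasure X)) (hP : ThinThick.IsDeterminantal l K P)
    (α β : unitInterval) (hβ : (β : ℝ) < 1) :
    ThinThick.IsDeterminantal l (fun x y => (α : ℂ) * K x y) (ThinThick.thinned α P) ∧
    IsProbabilityMeasure (ThinThick.thickened β P) ∧
    ((∀ ψ ∈ ThinThick.CcPos X, ∃ d : ℂ, ThinThick.HasFredholmDet l
        (ThinThick.cutKernel (fun x => 1 - Real.exp (-ψ x)) K (tsupport ψ)) d) →
      (∀ ψ ∈ ThinThick.CcPos X, ThinThick.HasFredholmDet l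
        (ThinThick.cutKernel (fun x => 1 - Real.exp (-ψ x)) (fun x y => (α : ℂ) * K x y)
          (tsupport ψ))
        (ThinThick.laplace (ThinThick.thinned α P) ψ)) ∧
      (∀ ψ ∈ ThinThick.CcPos X, ThinThick.HasFredholmDet l
        (ThinThick.cutKernel
          (fun x => (1 - Real.exp (-ψ x)) / (1 - β + β * (1 - Real.exp (-ψ x)))) K (tsupport ψ))
        (ThinThick.laplace (ThinThick.thickened β P) ψ)) ∧
      (LocallyCompactSpace X → ∀ Q : Measure (ThinThick.CountingMeasure X),
        IsProbabilityMeasure Q →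
        (∀ ψ ∈ ThinThick.CcPos X, ThinThick.HasFredholmDet l
          (ThinThick.cutKernel
            (fun x => (1 - Real.exp (-ψ x)) / (1 - β + β * (1 - Real.exp (-ψ x)))) K (tsupport ψ))
          (ThinThick.laplace Q ψ)) →
        Q = ThinThick.thickened β P)) := by
  have := hP.isProbabilityMeasure
  have hprob : IsProbabilityMeasure (ThinThick.thickened β P) :=
    ThinThick.isProbabilityMeasure_randomMultiplicity _ P
  refine ⟨ThinThick.isDeterminantal_thinned hP α, hprob, fun h => ⟨fun ψ hψ => ?_, fun ψ hψ =>
    hP.hasFredholmDet_laplace_thickened β hβ h hψ, fun _ Q _ hQ =>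
      ThinThick.eq_of_laplace_eq fun ψ hψ => ?_⟩⟩
  · obtain ⟨d, hd⟩ := h ψ hψ
    exact hP.hasFredholmDet_laplace_thinned α hψ hd
  -- Both Laplace functionals are sums of the same Fredholm series.
  · exact Complex.ofReal_injective
      ((hQ ψ hψ).unique (hP.hasFredholmDet_laplace_thickened β hβ h hψ))
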